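/- **Theorem 2.1.** Let $n\ge 1$, $p>1$, and let $u\in C^6(\mathbb R^n)$ be a (classical, possibly sign-changing) solution of $$(-\Delta)^3u=|u|^{p-1}u\quad\text{in }\mathbb R^n .$$ Put $k=\frac{6}{p-1}$ and $$\begin{aligned} \delta_1&=2(n-1)-4k,\qquad \delta_2=6k(1+k)-6(n-1)k+(n-1)(n-3),\\ \delta_3&=-4k(1+k)(2+k)+6(n-1)k(1+k)-(n-1)(n-3)(1+2k),\\ \delta_4&=k(1+k)(2+k)(3+k)-2(n-1)k(1+k)(2+k)+(n-1)(n-3)k(2+k),\\ \alpha&=n-3-2k,\qquad \beta=k(4+k-n). \end{aligned}$$ Fix $x\in\mathbb R^n$. For $\lambda>0$ let $B_\lambda=\{y:|y-x|<\lambda\}$, $r=|y-x|$, $\partial_r f(y)=\nabla f(y)\cdot\frac{y-x}{r}$, and write $$\begin{aligned} T_1&=ku+\lambda\partial_ru,\qquad T_2=k(k-1)u+2k\lambda\partial_ru+\lambda^2\partial_{rr}u,\\ T_3&=k(k-1)(k-2)u+3k(k-1)\lambda\partial_ru+3k\lambda^2\partial_{rr}u+\lambda^3\partial_{rrr}u,\\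 T_4&=k(k-1)(k-2)(k-3)u+4k(k-1)(k-2)\lambda\partial_ru+6k(k-1)\lambda^2\partial_{rr}u+4k\lambda^3\partial_{rrr}u+\lambda^4\partial_{rrrr}u,\\ G&=\lambda^2\Delta u-\lambda^2\partial_{rr}u-(n-1)\lambda\partial_ru,\qquad |\nabla^{\tan}f|^2=|\nabla f|^2-|\partial_rf|^2 . \end{aligned}$$ Let $e=6\frac{p+1}{p-1}-n$ (so that $e-5=2k+1-n$) and $$\begin{aligned} E(\lambda,x,u)={}&\lambda^{e}\Big(\int_{B_\lambda}\tfrac12|\nabla\Delta u|^2-\tfrac1{p+1}\int_{B_\lambda}|u|^{p+1}\Big) -\int_{\partial B_\lambda}\lambda^{e-5}T_4T_1+2\int_{\partial B_\lambda}\lambda^{e-5}T_3T_2\\ &-(\delta_1-6)\int_{\partial B_\lambda}\lambda^{e-5}T_3T_1+\tfrac12(k+2)\lambda^{e-1}\int_{\partial B_\lambda}(\Delta u)^2 -(24-6\delta_1+\delta_2)\int_{\partial B_\lambda}\lambda^{e-5}T_2T_1\\ &-(9\delta_1-3\delta_2-36)\int_{\partial B_\lambda}\lambda^{e-5}T_1^2+(\delta_1-8)\int_{\partial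 B_\lambda}\lambda^{e-5}T_2^2 +\delta_4\int_{\partial B_\lambda}\lambda^{e-5}T_1u+2\delta_4\int_{\partial B_\lambda}\lambda^{e-5}u^2\\ &+2\int_{\partial B_\lambda}\lambda^{e-5}G^2+\tfrac12\int_{\partial B_\lambda}\lambda^{2-n}\frac{d}{d\lambda}\big[\lambda^{2k}G^2\big]\\ &-4(\beta-n+4)\int_{\partial B_\lambda}\lambda^{e-5}\lambda^2|\nabla^{\tan}u|^2-(\beta-n+4)\int_{\partial B_\lambda}\lambda^{2-n}\frac{d}{d\lambda}\big[\lambda^{2k}\lambda^2|\nabla^{\tan}u|^2\big]\\ &-6\int_{\partial B_\lambda}\lambda^{e-5}\lambda^2|\nabla^{\tan}T_1|^2+\int_{\partial B_\lambda}\lambda^{4-n}\frac{d}{d\lambda}\big[\lambda^{2k}|\nabla^{\tan}T_1|^2\big]. \end{aligned}$$ Here $\lambda$ is held constant inside $\nabla^{\tan}T_1$, and $\frac{d}{d\lambda}[\cdots]$ at $y=x+\lambda\theta\in\partial B_\lambda$ is the derivative in $\lambda$, with $\theta$ fixed, of the bracket evaluated at $x+\lambda\theta$; surface integrals are with respect to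 surface measure. Let $u^\lambda(y)=\lambda^{k}u(x+\lambda y)$, let $\partial B_1$ on the right-hand side below be the unit sphere centred at the origin, and let $\nabla_\theta$, $\mathbf{div}_\theta$ be the gradient and divergence on it. Then $E(\cdot,x,u)$ is differentiable on $(0,\infty)$, and for every $\lambda>0$ $$\begin{aligned} \frac{dE(\lambda,x,u)}{d\lambda}={}&\int_{\partial B_1}\Big(2\lambda^5\Big(\frac{d^3u^\lambda}{d\lambda^3}\Big)^2+(10\delta_1-2\delta_2-56)\lambda^3\Big(\frac{d^2u^\lambda}{d\lambda^2}\Big)^2\\ &\qquad+(-18\delta_1+6\delta_2-4\delta_3+2\delta_4+72)\lambda\Big(\frac{du^\lambda}{d\lambda}\Big)^2\Big)\\ &+\int_{\partial B_1}\Big(4\lambda^3\Big|\frac{d^2}{d\lambda^2}\nabla_\theta u^\lambda\Big|^2+(8\alpha-4\beta+4n-28)\lambda\Big|\frac{d}{d\lambda}\nabla_\theta u^\lambda\Big|^2\Big)\\ &+2\lambda\int_{\partial B_1}\Big[\frac{d}{d\lambda}\mathbf{div}_\theta(\nabla_\theta u^\lambda)\Big]^2+\lambda\int_{\partial B_1}\Big(\frac{d\,\Delta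 u^\lambda}{d\lambda}\Big)^2 . \end{aligned}$$ -/

import Mathlib

open MeasureTheory
open scoped Laplacian Gradient

noncomputable section

namespace Triharmonic

/-- `ℝⁿ` with its Euclidean norm. -/
abbrev Space (n : ℕ) : Type := EuclideanSpace ℝ (Fin n)

/-- The scaling exponent `6 / (p - 1)`. -/
def kappa (p : ℝ) : ℝ := 6 / (p - 1)

def delta1 (n : ℕ) (p : ℝ) : ℝ := 2 * ((n : ℝ) - 1) - 4 * kappa p

def delta2 (n : ℕ) (p : ℝ) : ℝ :=
  6 * kappa p * (1 + kappa p) - 6 * ((n : ℝ) - 1) * kappa p + ((n : ℝ) - 1) * ((n : ℝ) - 3)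

def delta3 (n : ℕ) (p : ℝ) : ℝ :=
  -4 * kappa p * (1 + kappa p) * (2 + kappa p) + 6 * ((n : ℝ) - 1) * kappa p * (1 + kappa p)
    - ((n : ℝ) - 1) * ((n : ℝ) - 3) * (1 + 2 * kappa p)

def delta4 (n : ℕ) (p : ℝ) : ℝ :=
  kappa p * (1 + kappa p) * (2 + kappa p) * (3 + kappa p)
    - 2 * ((n : ℝ) - 1) * kappa p * (1 + kappa p) * (2 + kappa p)
    + ((n : ℝ) - 1) * ((n : ℝ) - 3) * kappa p * (2 + kappa p)

def alpha (n : ℕ) (p : ℝ) : ℝ := (n : ℝ) - 3 - 2 * kappa p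

def beta (n : ℕ) (p : ℝ) : ℝ := kappa p * (4 + kappa p - (n : ℝ))

variable {n : ℕ}

/-- The operator `-Δ`. -/
def negLaplacian (u : Space n → ℝ) : Space n → ℝ := fun y => -(Δ u) y

/-- `u` is a classical solution of `(-Δ)³ u = |u|^(p-1) u` in `ℝⁿ`. -/
structure IsSolution (p : ℝ) (u : Space n → ℝ) : Prop where
  contDiff : ContDiff ℝ 6 u
  equation : ∀ y, (negLaplacian^[3] u) y = |u y| ^ (p - 1) * u y

/-- The radial derivative `∂_r u (y) = ∇u(y) · (y - x) / |y - x|` with respect to the centre `x`. -/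
def radialDeriv (x : Space n) (u : Space n → ℝ) (y : Space n) : ℝ :=
  inner ℝ (∇ u y) (‖y - x‖⁻¹ • (y - x))

/-- Integration over the unit sphere `∂B₁` against surface measure. -/
def unitSphereIntegral (f : Space n → ℝ) : ℝ :=
  ∫ θ : Metric.sphere (0 : Space n) 1, f (θ : Space n) ∂((volume : Measure (Space n)).toSphere)

/-- Integration over the sphere `∂B_r(x)` against surface measure (`1 ≤ n`, `0 < r`). -/
def sphereIntegral (x : Space n) (r : ℝ) (f : Space n → ℝ) : ℝ :=
  r ^ (n - 1) * unitSphereIntegral fun θ => f (x + r • θ)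

/-- The extension of a function on the unit sphere that is constant along rays from the origin;
it depends on the values of `F` on the unit sphere only (off the origin). -/
def rayExtension {G : Type*} (F : Space n → G) : Space n → G := fun y => F (‖y‖⁻¹ • y)

/-- The gradient on the unit sphere of the restriction of `f` to it, as a vector of `ℝⁿ` tangent
to the sphere. -/
def angularGradient (f : Space n → ℝ) (θ : Space n) : Space n := ∇ (rayExtension f) θ

/-- The divergence on the unit sphere of a tangent vector field. -/
def angularDiv (X : Space n → Space n) (θ : Space n) : ℝ :=
  LinearMap.trace ℝ (Space n) (fderiv ℝ (rayExtension X) θ : Space n →ₗ[ℝ] Space n)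

/-- The rescaling `u^lam` about the point `x`. -/
def rescale (p : ℝ) (x : Space n) (u : Space n → ℝ) (lam : ℝ) : Space n → ℝ :=
  fun y => lam ^ kappa p * u (x + lam • y)

/-- `κ u + lam ∂_r u`, where `κ = 6 / (p - 1)`. -/
def T1 (p : ℝ) (x : Space n) (u : Space n → ℝ) (lam : ℝ) (y : Space n) : ℝ :=
  kappa p * u y + lam * radialDeriv x u y

/-- `κ(κ-1) u + 2κ lam ∂_r u + lam² ∂_rr u`. -/
def T2 (p : ℝ) (x : Space n) (u : Space n → ℝ) (lam : ℝ) (y : Space n) : ℝ :=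
  kappa p * (kappa p - 1) * u y + 2 * kappa p * lam * radialDeriv x u y
    + lam ^ 2 * ((radialDeriv x)^[2] u) y

/-- `κ(κ-1)(κ-2) u + 3κ(κ-1) lam ∂_r u + 3κ lam² ∂_rr u + lam³ ∂_rrr u`. -/
def T3 (p : ℝ) (x : Space n) (u : Space n → ℝ) (lam : ℝ) (y : Space n) : ℝ :=
  kappa p * (kappa p - 1) * (kappa p - 2) * u y
    + 3 * kappa p * (kappa p - 1) * lam * radialDeriv x u y
    + 3 * kappa p * lam ^ 2 * ((radialDeriv x)^[2] u) y
    + lam ^ 3 * ((radialDeriv x)^[3] u) y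

/-- `κ(κ-1)(κ-2)(κ-3) u + 4κ(κ-1)(κ-2) lam ∂_r u + 6κ(κ-1) lam² ∂_rr u + 4κ lam³ ∂_rrr u
+ lam⁴ ∂_rrrr u`. -/
def T4 (p : ℝ) (x : Space n) (u : Space n → ℝ) (lam : ℝ) (y : Space n) : ℝ :=
  kappa p * (kappa p - 1) * (kappa p - 2) * (kappa p - 3) * u y
    + 4 * kappa p * (kappa p - 1) * (kappa p - 2) * lam * radialDeriv x u y
    + 6 * kappa p * (kappa p - 1) * lam ^ 2 * ((radialDeriv x)^[2] u) y
    + 4 * kappa p * lam ^ 3 * ((radialDeriv x)^[3] u) y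
    + lam ^ 4 * ((radialDeriv x)^[4] u) y

/-- `lam² Δu - lam² ∂_rr u - (n-1) lam ∂_r u`. -/
def angularPart (x : Space n) (u : Space n → ℝ) (lam : ℝ) (y : Space n) : ℝ :=
  lam ^ 2 * (Δ u) y - lam ^ 2 * ((radialDeriv x)^[2] u) y
    - ((n : ℝ) - 1) * lam * radialDeriv x u y

/-- `|∇f|² - |∂_r f|²`. -/
def tangentialSq (x : Space n) (f : Space n → ℝ) (y : Space n) : ℝ :=
  ‖∇ f y‖ ^ 2 - (radialDeriv x f y) ^ 2

/-- For `y ∈ ∂B_lam(x)`, the derivative at `t = lam` of `t^(12/(p-1)) Q t`, where `Q t` is evaluated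
at the point of `∂B_t(x)` on the ray from `x` through `y`. -/
def rayDeriv (p : ℝ) (x : Space n) (Q : ℝ → Space n → ℝ) (lam : ℝ) (y : Space n) : ℝ :=
  deriv (fun t : ℝ => t ^ (2 * kappa p) * Q t (x + (t / lam) • (y - x))) lam

/-- The energy `E(lam, x, u)`. -/
def energy (p lam : ℝ) (x : Space n) (u : Space n → ℝ) : ℝ :=
  let e : ℝ := 6 * ((p + 1) / (p - 1)) - n
  lam ^ e * ((∫ y in Metric.ball x lam, 1 / 2 * ‖∇ (Δ u) y‖ ^ 2)
      - 1 / (p + 1) * ∫ y in Metric.ball x lam, |u y| ^ (p + 1))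
    - sphereIntegral x lam (fun y => lam ^ (e - 5) * (T4 p x u lam y * T1 p x u lam y))
    + 2 * sphereIntegral x lam (fun y => lam ^ (e - 5) * (T3 p x u lam y * T2 p x u lam y))
    - (delta1 n p - 6)
      * sphereIntegral x lam (fun y => lam ^ (e - 5) * (T3 p x u lam y * T1 p x u lam y))
    + 1 / 2 * (kappa p + 2) * lam ^ (e - 1) * sphereIntegral x lam (fun y => (Δ u) y ^ 2)
    - (24 - 6 * delta1 n p + delta2 n p)
      * sphereIntegral x lam (fun y => lam ^ (e - 5) * (T2 p x u lam y * T1 p x u lam y))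
    - (9 * delta1 n p - 3 * delta2 n p - 36)
      * sphereIntegral x lam (fun y => lam ^ (e - 5) * T1 p x u lam y ^ 2)
    + (delta1 n p - 8)
      * sphereIntegral x lam (fun y => lam ^ (e - 5) * T2 p x u lam y ^ 2)
    + delta4 n p * sphereIntegral x lam (fun y => lam ^ (e - 5) * (T1 p x u lam y * u y))
    + 2 * delta4 n p * sphereIntegral x lam (fun y => lam ^ (e - 5) * u y ^ 2)
    + 2 * sphereIntegral x lam (fun y => lam ^ (e - 5) * angularPart x u lam y ^ 2)
    + 1 / 2 * sphereIntegral x lam (fun y =>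
        lam ^ (2 - (n : ℝ)) * rayDeriv p x (fun t z => angularPart x u t z ^ 2) lam y)
    - 4 * (beta n p - n + 4)
      * sphereIntegral x lam (fun y => lam ^ (e - 5) * (lam ^ 2 * tangentialSq x u y))
    - (beta n p - n + 4) * sphereIntegral x lam (fun y =>
        lam ^ (2 - (n : ℝ)) * rayDeriv p x (fun t z => t ^ 2 * tangentialSq x u z) lam y)
    - 6 * sphereIntegral x lam (fun y =>
        lam ^ (e - 5) * (lam ^ 2 * tangentialSq x (T1 p x u lam) y))
    + sphereIntegral x lam (fun y =>
        lam ^ (4 - (n : ℝ)) * rayDeriv p x (fun t z => tangentialSq x (T1 p x u t) z) lam y)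

end Triharmonic

end

/-!
Translate `x` to the origin. On functions of the form `t ↦ t ^ c * f (t • θ)` the operator `t d/dt`
acts as `y · ∇ + c` on `f`, so that every `λ`-derivative in the theorem is an expression in the
functions `W j` given by `W j (t • θ) = t ^ (j - κ) * d^j/dt^j (t ^ κ * u (t • θ))`. In these
terms `‖y‖⁴ Δ²u` is a constant coefficient combination of the `W j` and their spherical Laplacians,
whose coefficients come from `δ₁, …, δ₄, α, β`.

By Green's formula for `Δ²`, applied to `W 1` and `Δu`, and by the equation, the derivative of the
scaled bulk energy is a flux through the sphere. Adding the derivative of the boundary terms and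
integrating by parts on the sphere, everything that is not a square cancels.
-/

noncomputable section

namespace Triharmonic

open Module Set
open scoped Topology

/-! ### The Euler operator and the divergence -/

section Euler

variable {E : Type*} [NormedAddCommGroup E] [NormedSpace ℝ E]
  {F : Type*} [NormedAddCommGroup F] [NormedSpace ℝ F]
  {G : Type*} [NormedAddCommGroup G] [NormedSpace ℝ G]

/-- The Euler operator `f ↦ y · ∇f`, the generator of the dilations. -/
def euler (f : E → F) (y : E) : F := fderiv ℝ f y y

variable {f g : E → F} {y : E}

theorem contDiff_euler {m N : WithTop ℕ∞} (hf : ContDiff ℝ N f) (h : m + 1 ≤ N) :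
    ContDiff ℝ m (euler f) :=
  (hf.fderiv_right h).clm_apply contDiff_id

theorem continuous_euler (hf : ContDiff ℝ 1 f) : Continuous (euler f) :=
  (contDiff_euler hf (m := 0) (by norm_num)).continuous

theorem euler_id (y : E) : euler (fun z : E => z) y = y := by
  simp [euler]

theorem euler_add (hf : DifferentiableAt ℝ f y) (hg : DifferentiableAt ℝ g y) :
    euler (fun z => f z + g z) y = euler f y + euler g y := by
  simp [euler, fderiv_fun_add hf hg]

theorem euler_sub (hf : DifferentiableAt ℝ f y) (hg : DifferentiableAt ℝ g y) :
    euler (fun z => f z - g z) y = euler f y - euler g y := by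
  simp [euler, fderiv_fun_sub hf hg]

theorem euler_smul {c : E → ℝ} (hc : DifferentiableAt ℝ c y) (hf : DifferentiableAt ℝ f y) :
    euler (fun z => c z • f z) y = c y • euler f y + euler c y • f y := by
  simp [euler, fderiv_fun_smul hc hf]

theorem euler_const_mul {f : E → ℝ} (hf : DifferentiableAt ℝ f y) (c : ℝ) :
    euler (fun z => c * f z) y = c * euler f y := by
  simp [euler, fderiv_const_mul hf]

theorem euler_clm_comp (L : F →L[ℝ] G) (hf : DifferentiableAt ℝ f y) :
    euler (fun z => L (f z)) y = L (euler f y) := by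
  have h : HasFDerivAt (fun z => L (f z)) (L ∘L fderiv ℝ f y) y :=
    L.hasFDerivAt.comp y hf.hasFDerivAt
  rw [euler, h.fderiv]
  rfl

theorem fderiv_euler (hf : ContDiff ℝ 2 f) (y : E) :
    fderiv ℝ (euler f) y = euler (fderiv ℝ f) y + fderiv ℝ f y := by
  have hd : DifferentiableAt ℝ (fderiv ℝ f) y :=
    (hf.fderiv_right (m := 1) (by norm_num)).differentiable one_ne_zero y
  have hsymm := hf.contDiffAt.isSymmSndFDerivAt (x := y) (by simp)
  ext v
  change fderiv ℝ (fun z => fderiv ℝ f z z) y v = _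
  rw [fderiv_clm_apply hd differentiableAt_fun_id]
  simp [euler, hsymm.eq v y, add_comm]

theorem hasDerivAt_ray (hf : Differentiable ℝ f) {r : ℝ} (hr : r ≠ 0) (θ : E) :
    HasDerivAt (fun t : ℝ => f (t • θ)) (r⁻¹ • euler f (r • θ)) r := by
  have h : HasDerivAt (fun t : ℝ => t • θ) θ r := by
    simpa using (hasDerivAt_id r).smul_const θ
  refine ((hf _).hasFDerivAt.comp_hasDerivAt r h).congr_deriv ?_
  rw [euler, map_smul, smul_smul, inv_mul_cancel₀ hr, one_smul]

end Euler

section Divergence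

variable {E : Type*} [NormedAddCommGroup E] [NormedSpace ℝ E] {X Y : E → E} {c : E → ℝ} {y : E}

/-- The divergence of a vector field, as the trace of its derivative. -/
def divergence (X : E → E) (y : E) : ℝ := LinearMap.trace ℝ E (fderiv ℝ X y)

theorem divergence_add (hX : DifferentiableAt ℝ X y) (hY : DifferentiableAt ℝ Y y) :
    divergence (fun z => X z + Y z) y = divergence X y + divergence Y y := by
  simp [divergence, fderiv_fun_add hX hY]

theorem divergence_sub (hX : DifferentiableAt ℝ X y) (hY : DifferentiableAt ℝ Y y) :
    divergence (fun z => X z - Y z) y = divergence X y - divergence Y y := by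
  simp [divergence, fderiv_fun_sub hX hY]

variable [FiniteDimensional ℝ E]

theorem divergence_smul (hc : DifferentiableAt ℝ c y) (hX : DifferentiableAt ℝ X y) :
    divergence (fun z => c z • X z) y = c y * divergence X y + fderiv ℝ c y (X y) := by
  simp only [divergence, fderiv_fun_smul hc hX, ContinuousLinearMap.toLinearMap_add,
    ContinuousLinearMap.toLinearMap_smul, map_add, map_smul, smul_eq_mul]
  congr 1
  exact LinearMap.trace_smulRight (fderiv ℝ c y : E →ₗ[ℝ] ℝ) (X y)

theorem divergence_smul_id (hc : DifferentiableAt ℝ c y) :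
    divergence (fun z => c z • z) y = finrank ℝ E * c y + euler c y := by
  rw [divergence_smul hc differentiableAt_fun_id, euler, mul_comm]
  simp [divergence]

theorem divergence_eq_clm_comp (X : E → E) :
    divergence X = fun y => LinearMap.toContinuousLinearMap
      (LinearMap.trace ℝ E ∘ₗ ContinuousLinearMap.coeLM ℝ) (fderiv ℝ X y) := rfl

theorem contDiff_divergence {m N : WithTop ℕ∞} (hX : ContDiff ℝ N X) (h : m + 1 ≤ N) :
    ContDiff ℝ m (divergence X) := by
  rw [divergence_eq_clm_comp]
  exact (ContinuousLinearMap.contDiff _).comp (hX.fderiv_right h)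

theorem continuous_divergence (hX : ContDiff ℝ 1 X) : Continuous (divergence X) :=
  (contDiff_divergence hX (m := 0) (by norm_num)).continuous

theorem divergence_euler (hX : ContDiff ℝ 2 X) (y : E) :
    divergence (euler X) y = euler (divergence X) y + divergence X y := by
  have hd : DifferentiableAt ℝ (fderiv ℝ X) y :=
    (hX.fderiv_right (m := 1) (by norm_num)).differentiable one_ne_zero y
  rw [divergence_eq_clm_comp X, euler_clm_comp _ hd, divergence_eq_clm_comp]
  simp only [fderiv_euler hX, map_add]

end Divergence

/-! ### Gradients, and the spherical gradient and Laplacian as homogeneous operators -/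

section Gradient

variable {E : Type*} [NormedAddCommGroup E] [InnerProductSpace ℝ E] {f g : E → ℝ} {y : E}

theorem differentiable_normSq : Differentiable ℝ fun z : E => ‖z‖ ^ 2 :=
  (contDiff_norm_sq ℝ (n := 1)).differentiable one_ne_zero

theorem euler_normSq (y : E) : euler (fun z : E => ‖z‖ ^ 2) y = 2 * ‖y‖ ^ 2 := by
  simp [euler, fderiv_norm_sq_apply]

theorem euler_inner {X Y : E → E} (hX : DifferentiableAt ℝ X y) (hY : DifferentiableAt ℝ Y y) :
    euler (fun z => inner ℝ (X z) (Y z)) y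
      = inner ℝ (euler X y) (Y y) + inner ℝ (X y) (euler Y y) := by
  rw [euler, fderiv_inner_apply ℝ hX hY, add_comm]
  rfl

variable [FiniteDimensional ℝ E]

theorem contDiff_gradient {m N : WithTop ℕ∞} (hf : ContDiff ℝ N f) (h : m + 1 ≤ N) :
    ContDiff ℝ m (∇ f) :=
  (InnerProductSpace.toDual ℝ E).symm.contDiff.comp (hf.fderiv_right h)

theorem inner_self_gradient (f : E → ℝ) (y : E) : inner ℝ y (∇ f y) = euler f y := by
  rw [real_inner_comm, inner_gradient_left, euler]

theorem gradient_add (hf : DifferentiableAt ℝ f y) (hg : DifferentiableAt ℝ g y) :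
    ∇ (fun z => f z + g z) y = ∇ f y + ∇ g y := by
  simp [gradient, fderiv_fun_add hf hg]

theorem gradient_mul (hf : DifferentiableAt ℝ f y) (hg : DifferentiableAt ℝ g y) :
    ∇ (fun z => f z * g z) y = f y • ∇ g y + g y • ∇ f y := by
  simp [gradient, fderiv_fun_mul hf hg]

theorem gradient_const_mul (hf : DifferentiableAt ℝ f y) (c : ℝ) :
    ∇ (fun z => c * f z) y = c • ∇ f y := by
  simp [gradient, fderiv_const_mul hf]

theorem gradient_normSq (y : E) : ∇ (fun z : E => ‖z‖ ^ 2) y = (2 : ℝ) • y := by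
  refine ext_inner_right ℝ fun v => ?_
  rw [inner_gradient_left, fderiv_norm_sq_apply, real_inner_smul_left]
  simp

theorem inner_fderiv_gradient (hf : ContDiff ℝ 2 f) (y v w : E) :
    inner ℝ (fderiv ℝ (∇ f) y v) w = fderiv ℝ (fderiv ℝ f) y v w := by
  have hd : DifferentiableAt ℝ (fderiv ℝ f) y :=
    (hf.fderiv_right (m := 1) (by norm_num)).differentiable one_ne_zero y
  have hg : DifferentiableAt ℝ (∇ f) y :=
    (contDiff_gradient hf (m := 1) (by norm_num)).differentiable one_ne_zero y
  have h : fderiv ℝ (fun z => inner ℝ (∇ f z) w) y v = fderiv ℝ (fun z => fderiv ℝ f z w) y v := by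
    simp only [inner_gradient_left]
  rw [fderiv_inner_apply ℝ hg (differentiableAt_const w),
    fderiv_clm_apply hd (differentiableAt_const w)] at h
  simpa using h

theorem gradient_euler (hf : ContDiff ℝ 2 f) (y : E) :
    ∇ (euler f) y = euler (∇ f) y + ∇ f y := by
  refine ext_inner_right ℝ fun v => ?_
  rw [inner_gradient_left, fderiv_euler hf, inner_add_left, inner_gradient_left, euler,
    euler, inner_fderiv_gradient hf]
  rfl

theorem laplacian_eq_divergence_gradient (hf : ContDiff ℝ 2 f) : Δ f = divergence (∇ f) := by
  funext y
  rw [divergence, LinearMap.trace_eq_sum_inner _ (stdOrthonormalBasis ℝ E),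
    InnerProductSpace.laplacian_eq_iteratedFDeriv_orthonormalBasis f (stdOrthonormalBasis ℝ E)]
  refine Finset.sum_congr rfl fun i _ => ?_
  rw [iteratedFDeriv_two_apply, real_inner_comm]
  exact (inner_fderiv_gradient hf y _ _).symm

theorem contDiff_laplacian {m N : WithTop ℕ∞} (hf : ContDiff ℝ N f) (h : m + 2 ≤ N) :
    ContDiff ℝ m (Δ f) := by
  rw [laplacian_eq_divergence_gradient (hf.of_le (le_trans (by simp) h))]
  have h' : m + 1 + 1 ≤ N := by rwa [add_assoc, one_add_one_eq_two]
  exact contDiff_divergence (contDiff_gradient hf h') le_rfl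

theorem laplacian_euler (hf : ContDiff ℝ 3 f) (y : E) :
    (Δ (euler f)) y = euler (Δ f) y + 2 * (Δ f) y := by
  have h2 : ContDiff ℝ 2 f := hf.of_le (by norm_num)
  have hg : ContDiff ℝ 2 (∇ f) := contDiff_gradient hf (by norm_num)
  have he : ContDiff ℝ 1 (euler (∇ f)) := contDiff_euler hg (by norm_num)
  rw [laplacian_eq_divergence_gradient (contDiff_euler hf (by norm_num)),
    laplacian_eq_divergence_gradient h2, funext (gradient_euler h2),
    divergence_add (he.differentiable one_ne_zero y) (hg.differentiable two_ne_zero y),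
    divergence_euler hg]
  ring

/-- `‖y‖² ∇f - (y · ∇f) y`: on the unit sphere it is the spherical gradient of `f`. -/
def sphGrad (f : E → ℝ) (y : E) : E := ‖y‖ ^ 2 • ∇ f y - euler f y • y

/-- The degree-zero extension of the spherical Laplacian; on the unit sphere, `Δ_θ f`. -/
def sphLaplacian (f : E → ℝ) : E → ℝ := divergence (sphGrad f)

/-- The degree-zero extension of `∇_θ f · ∇_θ g`. -/
def sphInner (f g : E → ℝ) (y : E) : ℝ := inner ℝ (∇ f y) (sphGrad g y)

theorem contDiff_sphGrad {m N : WithTop ℕ∞} (hf : ContDiff ℝ N f) (h : m + 1 ≤ N) :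
    ContDiff ℝ m (sphGrad f) :=
  ((contDiff_norm_sq ℝ).smul (contDiff_gradient hf h)).sub
    ((contDiff_euler hf h).smul contDiff_id)

theorem contDiff_sphLaplacian {m N : WithTop ℕ∞} (hf : ContDiff ℝ N f) (h : m + 2 ≤ N) :
    ContDiff ℝ m (sphLaplacian f) :=
  contDiff_divergence (contDiff_sphGrad hf (by rwa [add_assoc, one_add_one_eq_two])) le_rfl

theorem contDiff_sphInner {m N : WithTop ℕ∞} (hf : ContDiff ℝ N f) (hg : ContDiff ℝ N g)
    (h : m + 1 ≤ N) : ContDiff ℝ m (sphInner f g) :=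
  (contDiff_gradient hf h).inner ℝ (contDiff_sphGrad hg h)

theorem inner_self_sphGrad (f : E → ℝ) (y : E) : inner ℝ y (sphGrad f y) = 0 := by
  rw [sphGrad, inner_sub_right, real_inner_smul_right, real_inner_smul_right, inner_self_gradient,
    real_inner_self_eq_norm_sq]
  ring

theorem sphInner_eq (f g : E → ℝ) (y : E) :
    sphInner f g y = ‖y‖ ^ 2 * inner ℝ (∇ f y) (∇ g y) - euler f y * euler g y := by
  rw [sphInner, sphGrad, inner_sub_right, real_inner_smul_right, real_inner_smul_right,
    real_inner_comm y, inner_self_gradient]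
  ring

theorem sphInner_comm (f g : E → ℝ) : sphInner f g = sphInner g f := by
  funext y
  rw [sphInner_eq, sphInner_eq, real_inner_comm, mul_comm (euler f y)]

theorem sphGrad_add (hf : DifferentiableAt ℝ f y) (hg : DifferentiableAt ℝ g y) :
    sphGrad (fun z => f z + g z) y = sphGrad f y + sphGrad g y := by
  rw [sphGrad, gradient_add hf hg, euler_add hf hg, sphGrad, sphGrad]
  module

theorem sphGrad_mul (hf : DifferentiableAt ℝ f y) (hg : DifferentiableAt ℝ g y) :
    sphGrad (fun z => f z * g z) y = f y • sphGrad g y + g y • sphGrad f y := by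
  have he : euler (fun z => f z * g z) y = f y * euler g y + euler f y * g y := euler_smul hf hg
  rw [sphGrad, gradient_mul hf hg, he, sphGrad, sphGrad]
  module

theorem sphGrad_const_mul (hf : DifferentiableAt ℝ f y) (c : ℝ) :
    sphGrad (fun z => c * f z) y = c • sphGrad f y := by
  rw [sphGrad, gradient_const_mul hf, euler_const_mul hf, sphGrad]
  module

theorem sphGrad_normSq_mul (hf : DifferentiableAt ℝ f y) :
    sphGrad (fun z => ‖z‖ ^ 2 * f z) y = ‖y‖ ^ 2 • sphGrad f y := by
  have h : sphGrad (fun z : E => ‖z‖ ^ 2) y = 0 := by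
    rw [sphGrad, gradient_normSq, euler_normSq]
    module
  rw [sphGrad_mul (differentiable_normSq y) hf, h, smul_zero, add_zero]

theorem norm_sphGrad_sq (f : E → ℝ) (y : E) :
    ‖sphGrad f y‖ ^ 2 = ‖y‖ ^ 2 * sphInner f f y := by
  rw [← real_inner_self_eq_norm_sq]
  nth_rw 1 [sphGrad]
  rw [inner_sub_left, real_inner_smul_left, real_inner_smul_left, inner_self_sphGrad, mul_zero,
    sub_zero, sphInner]

theorem euler_sphGrad (hf : ContDiff ℝ 2 f) (y : E) :
    euler (sphGrad f) y = sphGrad (euler f) y + sphGrad f y := by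
  have hg : DifferentiableAt ℝ (∇ f) y :=
    (contDiff_gradient hf (m := 1) (by norm_num)).differentiable one_ne_zero y
  have he : DifferentiableAt ℝ (euler f) y :=
    (contDiff_euler hf (m := 1) (by norm_num)).differentiable one_ne_zero y
  change euler (fun z => ‖z‖ ^ 2 • ∇ f z - euler f z • z) y = _
  rw [euler_sub ((differentiable_normSq y).fun_smul hg) (he.fun_smul differentiableAt_fun_id),
    euler_smul (differentiable_normSq y) hg, euler_smul he differentiableAt_fun_id, euler_normSq,
    euler_id, sphGrad, gradient_euler hf, sphGrad]
  module

theorem sphLaplacian_add (hf : ContDiff ℝ 2 f) (hg : ContDiff ℝ 2 g) (y : E) :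
    sphLaplacian (fun z => f z + g z) y = sphLaplacian f y + sphLaplacian g y := by
  have hS {h : E → ℝ} (hh : ContDiff ℝ 2 h) : DifferentiableAt ℝ (sphGrad h) y :=
    (contDiff_sphGrad hh (m := 1) (by norm_num)).differentiable one_ne_zero y
  have h : sphGrad (fun z => f z + g z) = fun z => sphGrad f z + sphGrad g z :=
    funext fun z => sphGrad_add (hf.differentiable two_ne_zero z) (hg.differentiable two_ne_zero z)
  rw [sphLaplacian, h, divergence_add (hS hf) (hS hg)]
  rfl

theorem sphLaplacian_const_mul (hf : ContDiff ℝ 2 f) (c : ℝ) (y : E) :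
    sphLaplacian (fun z => c * f z) y = c * sphLaplacian f y := by
  have hS : DifferentiableAt ℝ (sphGrad f) y :=
    (contDiff_sphGrad hf (m := 1) (by norm_num)).differentiable one_ne_zero y
  have h : sphGrad (fun z => c * f z) = fun z => c • sphGrad f z :=
    funext fun z => sphGrad_const_mul (hf.differentiable two_ne_zero z) c
  rw [sphLaplacian, h, divergence_smul (differentiableAt_const c) hS]
  simp [sphLaplacian]

theorem sphLaplacian_normSq_mul (hf : ContDiff ℝ 2 f) (y : E) :
    sphLaplacian (fun z => ‖z‖ ^ 2 * f z) y = ‖y‖ ^ 2 * sphLaplacian f y := by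
  have hS : DifferentiableAt ℝ (sphGrad f) y :=
    (contDiff_sphGrad hf (m := 1) (by norm_num)).differentiable one_ne_zero y
  have h : sphGrad (fun z => ‖z‖ ^ 2 * f z) = fun z => ‖z‖ ^ 2 • sphGrad f z :=
    funext fun z => sphGrad_normSq_mul (hf.differentiable two_ne_zero z)
  rw [sphLaplacian, h, divergence_smul (differentiable_normSq y) hS, fderiv_norm_sq_apply]
  simp [inner_self_sphGrad, sphLaplacian]

theorem euler_sphLaplacian (hf : ContDiff ℝ 3 f) (y : E) :
    euler (sphLaplacian f) y = sphLaplacian (euler f) y := by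
  have hS : ContDiff ℝ 2 (sphGrad f) := contDiff_sphGrad hf (by norm_num)
  have he : ContDiff ℝ 1 (sphGrad (euler f)) :=
    contDiff_sphGrad (contDiff_euler hf (m := 2) (by norm_num)) (by norm_num)
  have h := divergence_euler hS y
  rw [funext (euler_sphGrad (hf.of_le (by norm_num))),
    divergence_add (he.differentiable one_ne_zero y) (hS.differentiable two_ne_zero y)] at h
  exact (add_right_cancel h).symm

theorem sphInner_add_left {h : E → ℝ} (hf : DifferentiableAt ℝ f y)
    (hg : DifferentiableAt ℝ g y) :
    sphInner (fun z => f z + g z) h y = sphInner f h y + sphInner g h y := by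
  rw [sphInner, gradient_add hf hg, inner_add_left, sphInner, sphInner]

theorem sphInner_const_mul_left {h : E → ℝ} (hf : DifferentiableAt ℝ f y) (c : ℝ) :
    sphInner (fun z => c * f z) h y = c * sphInner f h y := by
  rw [sphInner, gradient_const_mul hf, real_inner_smul_left, sphInner]

theorem euler_sphInner (hf : ContDiff ℝ 2 f) (hg : ContDiff ℝ 2 g) (y : E) :
    euler (sphInner f g) y = sphInner (euler f) g y + sphInner f (euler g) y := by
  have hG : ContDiff ℝ 1 (∇ f) := contDiff_gradient hf (by norm_num)
  have hS : ContDiff ℝ 1 (sphGrad g) := contDiff_sphGrad hg (by norm_num)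
  change euler (fun z => inner ℝ (∇ f z) (sphGrad g z)) y = _
  rw [euler_inner (hG.differentiable one_ne_zero y) (hS.differentiable one_ne_zero y),
    euler_sphGrad hg, inner_add_right, sphInner, gradient_euler hf, inner_add_left, sphInner]
  ring

theorem normSq_mul_laplacian (hf : ContDiff ℝ 2 f) (y : E) :
    ‖y‖ ^ 2 * (Δ f) y
      = euler (euler f) y + ((finrank ℝ E : ℝ) - 2) * euler f y + sphLaplacian f y := by
  have hG : ContDiff ℝ 1 (∇ f) := contDiff_gradient hf (by norm_num)
  have he : ContDiff ℝ 1 (euler f) := contDiff_euler hf (by norm_num)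
  have hGd := hG.differentiable one_ne_zero y
  have hed := he.differentiable one_ne_zero y
  have h : sphLaplacian f y = divergence (fun z => ‖z‖ ^ 2 • ∇ f z - euler f z • z) y := rfl
  rw [h, divergence_sub ((differentiable_normSq y).fun_smul hGd)
    (hed.fun_smul differentiableAt_fun_id), divergence_smul (differentiable_normSq y) hGd,
    divergence_smul_id hed, ← laplacian_eq_divergence_gradient hf, fderiv_norm_sq_apply]
  simp only [coe_innerSL_apply, smul_apply, inner_self_gradient]
  ring

end Gradient

/-! ### Integration over spheres and the divergence theorem on balls -/

section SphereIntegral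

variable {E : Type*} [NormedAddCommGroup E] [InnerProductSpace ℝ E] [FiniteDimensional ℝ E]
  [MeasurableSpace E] [BorelSpace E] {f g : E → ℝ} {X : E → E} {r R : ℝ}

/-- The integral over the unit sphere of `θ ↦ f (r θ)`, against surface measure. -/
def sphIntegral (f : E → ℝ) (r : ℝ) : ℝ :=
  ∫ θ : Metric.sphere (0 : E) 1, f (r • (θ : E)) ∂(volume : Measure E).toSphere

/-- The outward flux of a vector field through the sphere of radius `r` about the origin. -/
def flux (X : E → E) (r : ℝ) : ℝ :=
  r ^ (finrank ℝ E - 1) * ∫ θ : Metric.sphere (0 : E) 1, inner ℝ (θ : E) (X (r • (θ : E)))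
    ∂(volume : Measure E).toSphere

theorem integrable_toSphere {h : Metric.sphere (0 : E) 1 → ℝ} (hh : Continuous h) :
    Integrable h (volume : Measure E).toSphere :=
  hh.integrable_of_hasCompactSupport (HasCompactSupport.of_compactSpace h)

theorem integrable_sphIntegral (hf : Continuous f) (r : ℝ) :
    Integrable (fun θ : Metric.sphere (0 : E) 1 => f (r • (θ : E))) (volume : Measure E).toSphere :=
  integrable_toSphere (by fun_prop)

theorem continuous_integral_toSphere {F : ℝ → E → ℝ} (hF : Continuous F.uncurry) :
    Continuous fun r =>
      ∫ θ : Metric.sphere (0 : E) 1, F r θ ∂(volume : Measure E).toSphere := by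
  have hc : Continuous fun q : ℝ × Metric.sphere (0 : E) 1 => F q.1 q.2 :=
    hF.comp (by fun_prop : Continuous fun q : ℝ × Metric.sphere (0 : E) 1 => (q.1, (q.2 : E)))
  simpa using continuous_parametric_integral_of_continuous
    (μ := (volume : Measure E).toSphere) hc isCompact_univ

theorem continuous_sphIntegral (hf : Continuous f) : Continuous (sphIntegral f) :=
  continuous_integral_toSphere (F := fun r θ => f (r • θ))
    (hf.comp (by fun_prop : Continuous fun q : ℝ × E => q.1 • q.2))

theorem continuous_flux (hX : Continuous X) : Continuous (flux X) :=
  (continuous_pow _).mul (continuous_integral_toSphere (F := fun r θ => inner ℝ θ (X (r • θ)))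
    (continuous_snd.inner (hX.comp (by fun_prop : Continuous fun q : ℝ × E => q.1 • q.2))))

theorem sphIntegral_congr (hr : 0 ≤ r) (h : ∀ y, ‖y‖ = r → f y = g y) :
    sphIntegral f r = sphIntegral g r :=
  integral_congr_ae (.of_forall fun θ => h _ (by simp [norm_smul, abs_of_nonneg hr]))

theorem sphIntegral_add (hf : Continuous f) (hg : Continuous g) (r : ℝ) :
    sphIntegral (fun y => f y + g y) r = sphIntegral f r + sphIntegral g r :=
  integral_add (integrable_sphIntegral hf r) (integrable_sphIntegral hg r)

theorem sphIntegral_sub (hf : Continuous f) (hg : Continuous g) (r : ℝ) :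
    sphIntegral (fun y => f y - g y) r = sphIntegral f r - sphIntegral g r :=
  integral_sub (integrable_sphIntegral hf r) (integrable_sphIntegral hg r)

theorem sphIntegral_const_mul (c : ℝ) (f : E → ℝ) (r : ℝ) :
    sphIntegral (fun y => c * f y) r = c * sphIntegral f r :=
  integral_const_mul c _

theorem flux_eq_sphIntegral (X : E → E) (hr : r ≠ 0) :
    flux X r = r ^ (finrank ℝ E - 1) * (r⁻¹ * sphIntegral (fun y => inner ℝ y (X y)) r) := by
  simp only [flux, sphIntegral, real_inner_smul_left, integral_const_mul, inv_mul_cancel_left₀ hr]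

theorem hasDerivAt_sphIntegral (hf : ContDiff ℝ 1 f) (hr : r ≠ 0) :
    HasDerivAt (sphIntegral f) (r⁻¹ * sphIntegral (euler f) r) r := by
  have he : Continuous (euler f) := continuous_euler hf
  obtain ⟨ε, hε, hball⟩ : ∃ ε > 0, ∀ t ∈ Metric.closedBall r ε, t ≠ 0 := by
    obtain ⟨ε, hε, h⟩ := Metric.nhds_basis_closedBall.mem_iff.1 (isOpen_ne.mem_nhds hr)
    exact ⟨ε, hε, fun t ht => h ht⟩
  have hc : ContinuousOn (fun q : ℝ × E => q.1⁻¹ • euler f (q.1 • q.2))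
      (Metric.closedBall r ε ×ˢ Metric.sphere 0 1) :=
    (continuousOn_fst.inv₀ fun q hq => hball q.1 hq.1).smul
      (he.comp (by fun_prop : Continuous fun q : ℝ × E => q.1 • q.2)).continuousOn
  obtain ⟨K, hK⟩ := ((isCompact_closedBall r ε).prod
    (isCompact_sphere (0 : E) 1)).exists_bound_of_continuousOn hc
  refine (hasDerivAt_integral_of_dominated_loc_of_deriv_le
    (F' := fun t (θ : Metric.sphere (0 : E) 1) => t⁻¹ • euler f (t • (θ : E)))
    (bound := fun _ => K) (Metric.closedBall_mem_nhds r hε)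
    (.of_forall fun t => (integrable_sphIntegral hf.continuous t).aestronglyMeasurable)
    (integrable_sphIntegral hf.continuous r)
    ((integrable_sphIntegral he r).const_mul r⁻¹).aestronglyMeasurable
    (.of_forall fun θ t ht => hK (t, θ) ⟨ht, θ.2⟩) (integrable_const K)
    (.of_forall fun θ t ht => hasDerivAt_ray (hf.differentiable one_ne_zero) (hball t ht) (θ : E))
    ).2.congr_deriv (integral_const_mul r⁻¹ _)

theorem integral_eq_integral_sphIntegral [Nontrivial E] (hf : Integrable f) :
    ∫ y, f y = ∫ r in Ioi (0 : ℝ), r ^ (finrank ℝ E - 1) * sphIntegral f r := by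
  set μ : Measure E := volume
  set d := finrank ℝ E
  have hpolar := μ.measurePreserving_homeomorphUnitSphereProd
  have hemb := (homeomorphUnitSphereProd E).measurableEmbedding
  let G : Metric.sphere (0 : E) 1 × Ioi (0 : ℝ) → ℝ := fun q => f (q.2.1 • (q.1 : E))
  have hG : G ∘ homeomorphUnitSphereProd E = f ∘ Subtype.val := by
    funext z
    have hz : ‖(z : E)‖ ≠ 0 := norm_ne_zero_iff.2 z.2
    simp [G, smul_smul, hz]
  have hint : Integrable G (μ.toSphere.prod (.volumeIoiPow (d - 1))) := by
    rw [← hpolar.integrable_comp_emb hemb, hG,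
      ← integrableOn_iff_comap_subtypeVal (measurableSet_singleton _).compl]
    exact hf.integrableOn
  calc
    ∫ y, f y = ∫ z : ({0}ᶜ : Set E), (G ∘ homeomorphUnitSphereProd E) z ∂(μ.comap (↑)) := by
      rw [hG]
      refine Eq.trans ?_ (integral_subtype_comap (measurableSet_singleton 0).compl f).symm
      rw [restrict_compl_singleton]
    _ = ∫ q, G q ∂μ.toSphere.prod (.volumeIoiPow (d - 1)) := hpolar.integral_comp hemb G
    _ = ∫ r : Ioi (0 : ℝ), sphIntegral f r ∂(.volumeIoiPow (d - 1)) := integral_prod_symm _ hint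
    _ = ∫ r in Ioi (0 : ℝ), Real.toNNReal (r ^ (d - 1)) • sphIntegral f r := by
      simp only [Measure.volumeIoiPow, ENNReal.ofReal]
      rw [integral_withDensity_eq_integral_smul
          (measurable_subtype_coe.pow_const _).real_toNNReal,
        integral_subtype_comap measurableSet_Ioi
          fun r => Real.toNNReal (r ^ (d - 1)) • sphIntegral f r]
    _ = _ := setIntegral_congr_fun measurableSet_Ioi fun r hr => by
      simp only [NNReal.smul_def, Real.coe_toNNReal _ (pow_nonneg (le_of_lt hr) _), smul_eq_mul]

theorem integral_ball_eq_integral_sphIntegral [Nontrivial E] (hf : Continuous f) (hR : 0 ≤ R) :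
    ∫ y in Metric.ball 0 R, f y
      = ∫ r in (0 : ℝ)..R, r ^ (finrank ℝ E - 1) * sphIntegral f r := by
  have hi : IntegrableOn f (Metric.ball 0 R) :=
    (hf.continuousOn.integrableOn_compact (isCompact_closedBall 0 R)).mono_set
      Metric.ball_subset_closedBall
  have hind : ∀ r : ℝ, 0 < r → sphIntegral ((Metric.ball 0 R).indicator f) r
      = (Iio R).indicator (sphIntegral f) r := by
    intro r hr
    by_cases hrR : r < R
    · rw [indicator_of_mem (mem_Iio.2 hrR)]
      exact sphIntegral_congr hr.le fun y hy => indicator_of_mem (by simpa [hy] using hrR) f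
    · rw [indicator_of_notMem (by simpa using hrR), sphIntegral_congr (g := fun _ => 0) hr.le
        fun y hy => indicator_of_notMem (by simpa [hy] using hrR) f]
      simp [sphIntegral]
  rw [← integral_indicator measurableSet_ball,
    integral_eq_integral_sphIntegral (hi.integrable_indicator measurableSet_ball),
    intervalIntegral.integral_of_le hR, integral_Ioc_eq_integral_Ioo, ← Ioi_inter_Iio,
    ← setIntegral_indicator measurableSet_Iio]
  refine setIntegral_congr_fun measurableSet_Ioi fun r hr => ?_
  simp only [hind r hr, indicator, mul_ite, mul_zero]

theorem hasDerivAt_integral_ball [Nontrivial E] (hf : Continuous f) (hR : 0 < R) :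
    HasDerivAt (fun r => ∫ y in Metric.ball 0 r, f y)
      (R ^ (finrank ℝ E - 1) * sphIntegral f R) R := by
  have hc : Continuous fun r : ℝ => r ^ (finrank ℝ E - 1) * sphIntegral f r :=
    (continuous_pow _).mul (continuous_sphIntegral hf)
  refine (intervalIntegral.integral_hasDerivAt_right (hc.intervalIntegrable 0 R)
    (hc.stronglyMeasurableAtFilter _ _) hc.continuousAt).congr_of_eventuallyEq ?_
  filter_upwards [lt_mem_nhds hR] with r hr
  exact integral_ball_eq_integral_sphIntegral hf hr.le

theorem integral_divergence_eq_zero (hX : ContDiff ℝ 1 X) (hs : HasCompactSupport X) :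
    ∫ y, divergence X y = 0 := by
  set b := stdOrthonormalBasis ℝ E
  have hD (v : E) : Integrable fun y => fderiv ℝ X y v :=
    ((hX.continuous_fderiv one_ne_zero).clm_apply continuous_const).integrable_of_hasCompactSupport
      (hs.fderiv_apply ℝ v)
  have hzero (v : E) : ∫ y, fderiv ℝ X y v = 0 := by
    simpa using integral_smul_fderiv_eq_neg_fderiv_smul_of_integrable (μ := (volume : Measure E))
      (f := fun _ => (1 : ℝ)) (g := X) (v := v) (by simp) (by simpa using hD v)
      (by simpa using hX.continuous.integrable_of_hasCompactSupport hs) (by simp)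
      fun y _ => hX.differentiable one_ne_zero y
  have htrace (y : E) : divergence X y = ∑ i, inner ℝ (b i) (fderiv ℝ X y (b i)) :=
    LinearMap.trace_eq_sum_inner _ b
  simp_rw [htrace]
  rw [integral_finsetSum _ fun i _ => (hD (b i)).const_inner (b i)]
  exact Finset.sum_eq_zero fun i _ => by rw [integral_inner (hD (b i)), hzero, inner_zero_right]

end SphereIntegral

section DivergenceTheorem

variable {E : Type*} [NormedAddCommGroup E] [InnerProductSpace ℝ E] {X : E → E} {r R : ℝ}

theorem contDiff_comp_norm {g : ℝ → ℝ} {N : WithTop ℕ∞} (hg : ContDiff ℝ N g)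
    (h0 : tsupport g ⊆ Ioi 0) : ContDiff ℝ N fun y : E => g ‖y‖ := by
  refine contDiff_iff_contDiffAt.2 fun y => ?_
  rcases eq_or_ne y 0 with rfl | hy
  · have hev : g =ᶠ[𝓝 ‖(0 : E)‖] fun _ => 0 :=
      notMem_tsupport_iff_eventuallyEq.1 fun h => by simpa using h0 h
    exact contDiffAt_const.congr_of_eventuallyEq (hev.comp_tendsto continuous_norm.continuousAt)
  · exact hg.contDiffAt.comp y (contDiffAt_norm ℝ hy)

theorem fderiv_comp_norm_of_inner_eq_zero {g : ℝ → ℝ} {y v : E}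
    (hg : DifferentiableAt ℝ (fun z : E => g ‖z‖) y) (h : inner ℝ y v = 0) :
    fderiv ℝ (fun z : E => g ‖z‖) y v = 0 := by
  have heven : (fun t : ℝ => g ‖y + t • v‖).Even := fun t => by
    have : ‖y + t • v‖ = ‖y - t • v‖ :=
      (norm_sub_eq_norm_add (by rw [real_inner_smul_left, real_inner_comm, h, mul_zero])).symm
    simp only [this, neg_smul, sub_eq_add_neg]
  rw [← hg.lineDeriv_eq_fderiv]
  have h0 := deriv_comp_neg (fun t : ℝ => g ‖y + t • v‖) 0
  rw [funext heven, neg_zero] at h0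
  exact self_eq_neg.1 h0

variable [FiniteDimensional ℝ E] [MeasurableSpace E] [BorelSpace E] [Nontrivial E]

theorem integral_smul_sphIntegral_divergence (hX : ContDiff ℝ 1 X) (ht : ∀ y, inner ℝ y (X y) = 0)
    {g : ℝ → ℝ} (hg : ContDiff ℝ 1 g) (hgs : HasCompactSupport g) (hg0 : tsupport g ⊆ Ioi 0) :
    ∫ t, g t • (t ^ (finrank ℝ E - 1) * sphIntegral (divergence X) t) = 0 := by
  have hφ : ContDiff ℝ 1 fun y : E => g ‖y‖ := contDiff_comp_norm hg hg0
  have hφd := hφ.differentiable one_ne_zero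
  have hY : ContDiff ℝ 1 fun y : E => g ‖y‖ • X y := hφ.smul hX
  have hs : HasCompactSupport fun y : E => g ‖y‖ • X y := by
    obtain ⟨M, -, hM⟩ := hgs.exists_pos_le_norm
    refine HasCompactSupport.intro (isCompact_closedBall 0 M) fun y hy => ?_
    rw [hM ‖y‖ (by simpa using le_of_lt (by simpa using hy)), zero_smul]
  have hdiv (y : E) : divergence (fun z => g ‖z‖ • X z) y = g ‖y‖ * divergence X y := by
    rw [divergence_smul (hφd y) (hX.differentiable one_ne_zero y),
      fderiv_comp_norm_of_inner_eq_zero (hφd y) (ht y), add_zero]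
  have hint : Integrable fun y : E => g ‖y‖ * divergence X y := by
    rw [← funext hdiv]
    refine (continuous_divergence hY).integrable_of_hasCompactSupport
      ((hs.fderiv ℝ).mono fun y hy h => hy ?_)
    simp [divergence, h]
  have h0 := integral_divergence_eq_zero hY hs
  rw [funext hdiv, integral_eq_integral_sphIntegral hint] at h0
  rw [← h0, ← setIntegral_eq_integral_of_forall_compl_eq_zero (s := Ioi 0) fun t ht => by
    rw [image_eq_zero_of_notMem_tsupport fun h => ht (hg0 h), zero_smul]]
  refine setIntegral_congr_fun measurableSet_Ioi fun t ht => ?_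
  have hgt : sphIntegral (fun y => g ‖y‖ * divergence X y) t = g t * sphIntegral (divergence X) t :=
    (sphIntegral_congr (le_of_lt ht) fun y hy => by rw [hy]).trans (sphIntegral_const_mul _ _ t)
  simp only [hgt, smul_eq_mul]
  ring

theorem sphIntegral_divergence_eq_zero (hX : ContDiff ℝ 1 X) (ht : ∀ y, inner ℝ y (X y) = 0)
    (hr : 0 < r) : sphIntegral (divergence X) r = 0 := by
  have hc : Continuous fun t : ℝ => t ^ (finrank ℝ E - 1) * sphIntegral (divergence X) t :=
    (continuous_pow _).mul (continuous_sphIntegral (continuous_divergence hX))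
  have hae := isOpen_Ioi.ae_eq_zero_of_integral_contDiff_smul_eq_zero
    (hc.locallyIntegrable.locallyIntegrableOn (Ioi 0)) fun g hg hgs hg0 =>
      integral_smul_sphIntegral_divergence hX ht (hg.of_le (by simp)) hgs hg0
  have heq := Measure.eqOn_open_of_ae_eq ((ae_restrict_iff' measurableSet_Ioi).2 hae) isOpen_Ioi
    hc.continuousOn continuousOn_const hr
  exact (mul_eq_zero.1 heq).resolve_left (pow_ne_zero _ hr.ne')

theorem sq_mul_sphIntegral_divergence (hX : ContDiff ℝ 1 X) (hr : 0 < r) :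
    r ^ 2 * sphIntegral (divergence X) r
      = ((finrank ℝ E : ℝ) - 2) * sphIntegral (fun y => inner ℝ y (X y)) r
        + sphIntegral (euler fun y => inner ℝ y (X y)) r := by
  set q : E → ℝ := fun y => inner ℝ y (X y)
  have hq : ContDiff ℝ 1 q := contDiff_id.inner ℝ hX
  have hqd := hq.differentiable one_ne_zero
  have hXd := hX.differentiable one_ne_zero
  -- the tangential part of `‖y‖² X`, whose divergence integrates to zero over spheres
  let Y : E → E := fun y => ‖y‖ ^ 2 • X y - q y • y
  have hY : ContDiff ℝ 1 Y := ((contDiff_norm_sq ℝ).smul hX).sub (hq.smul contDiff_id)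
  have hYtan (y : E) : inner ℝ y (Y y) = 0 := by
    simp only [Y, q, inner_sub_right, real_inner_smul_right, real_inner_self_eq_norm_sq]
    ring
  have hdiv (y : E) :
      ‖y‖ ^ 2 * divergence X y = divergence Y y + ((finrank ℝ E - 2) * q y + euler q y) := by
    rw [divergence_sub ((differentiable_normSq y).fun_smul (hXd y))
      ((hqd y).fun_smul differentiableAt_fun_id), divergence_smul (differentiable_normSq y) (hXd y),
      divergence_smul_id (hqd y), fderiv_norm_sq_apply]
    simp only [coe_innerSL_apply, smul_apply, q]
    ring
  have hYc := continuous_divergence hY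
  have hqc := hq.continuous
  have hEc := continuous_euler hq
  rw [← sphIntegral_const_mul, sphIntegral_congr hr.le fun y hy => by rw [← hy, hdiv],
    sphIntegral_add hYc (by fun_prop), sphIntegral_divergence_eq_zero hY hYtan hr, zero_add,
    sphIntegral_add (by fun_prop) hEc, sphIntegral_const_mul]

theorem hasDerivAt_flux (hX : ContDiff ℝ 1 X) (hr : 0 < r) :
    HasDerivAt (flux X) (r ^ (finrank ℝ E - 1) * sphIntegral (divergence X) r) r := by
  set q : E → ℝ := fun y => inner ℝ y (X y)
  have hq : ContDiff ℝ 1 q := contDiff_id.inner ℝ hX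
  have hpow (t : ℝ) : t ^ (finrank ℝ E - 1) = t ^ ((finrank ℝ E : ℤ) - 1) := by
    rw [← zpow_natCast, Nat.cast_pred finrank_pos]
  have hev : flux X =ᶠ[𝓝 r] fun t => t ^ ((finrank ℝ E : ℤ) - 2) * sphIntegral q t := by
    filter_upwards [lt_mem_nhds hr] with t ht
    rw [flux_eq_sphIntegral X ht.ne', hpow, ← mul_assoc, ← zpow_sub_one₀ ht.ne']
    congr 2
    ring
  have h1 : r ^ ((finrank ℝ E : ℤ) - 1) = r ^ ((finrank ℝ E : ℤ) - 2 - 1) * r ^ 2 := by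
    rw [← zpow_natCast r 2, ← zpow_add₀ hr.ne']
    congr 1
    push_cast
    ring
  refine (((hasDerivAt_zpow _ r (.inl hr.ne')).mul (hasDerivAt_sphIntegral hq hr.ne')
    ).congr_of_eventuallyEq hev).congr_deriv ?_
  rw [hpow, h1, mul_assoc _ (r ^ 2), sq_mul_sphIntegral_divergence hX hr, ← mul_assoc _ r⁻¹,
    ← zpow_sub_one₀ hr.ne']
  push_cast
  ring

theorem sphIntegral_inner_right (v : E) : sphIntegral (fun y => inner ℝ y v) 1 = 0 := by
  set c := sphIntegral (fun y => inner ℝ y v) 1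
  have hodd : ∫ y in Metric.ball (0 : E) 1, inner ℝ y v = 0 := by
    rw [← integral_indicator measurableSet_ball]
    refine self_eq_neg.1 (Eq.trans ?_ (integral_neg _))
    rw [← integral_neg_eq_self]
    refine integral_congr_ae (.of_forall fun y => ?_)
    by_cases hy : ‖y‖ < 1 <;> simp [indicator, hy]
  have hhom (r : ℝ) : sphIntegral (fun y : E => inner ℝ y v) r = r * c := by
    simp only [c, sphIntegral, real_inner_smul_left, integral_const_mul, one_mul]
  rw [integral_ball_eq_integral_sphIntegral (by fun_prop) zero_le_one] at hodd
  simp_rw [hhom, ← mul_assoc, ← pow_succ] at hodd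
  rw [intervalIntegral.integral_mul_const, integral_pow] at hodd
  exact (mul_eq_zero.1 hodd).resolve_left (by
    rw [one_pow, zero_pow (Nat.succ_ne_zero _), sub_zero]
    positivity)

theorem flux_zero (X : E → E) : flux X 0 = 0 := by
  have h := sphIntegral_inner_right (X 0)
  simp only [sphIntegral, one_smul] at h
  simp only [flux, zero_smul, h, mul_zero]

theorem integral_ball_divergence (hX : ContDiff ℝ 1 X) (hR : 0 ≤ R) :
    ∫ y in Metric.ball 0 R, divergence X y = flux X R := by
  have hc := continuous_divergence hX
  have hcp : Continuous fun t : ℝ => t ^ (finrank ℝ E - 1) * sphIntegral (divergence X) t :=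
    (continuous_pow _).mul (continuous_sphIntegral hc)
  rw [integral_ball_eq_integral_sphIntegral hc hR,
    intervalIntegral.integral_eq_sub_of_hasDerivAt_of_le hR
      (continuous_flux hX.continuous).continuousOn (fun t ht => hasDerivAt_flux hX ht.1)
      (hcp.intervalIntegrable 0 R), flux_zero, sub_zero]

end DivergenceTheorem

section Green

variable {E : Type*} [NormedAddCommGroup E] [InnerProductSpace ℝ E] [FiniteDimensional ℝ E]
  [MeasurableSpace E] [BorelSpace E] [Nontrivial E] {f g : E → ℝ} {r : ℝ}

theorem sphIntegral_mul_sphLaplacian_add_sphInner (hf : ContDiff ℝ 1 f) (hg : ContDiff ℝ 2 g)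
    (hr : 0 < r) : sphIntegral (fun y => f y * sphLaplacian g y + sphInner f g y) r = 0 := by
  have hS : ContDiff ℝ 1 (sphGrad g) := contDiff_sphGrad hg (by norm_num)
  have hdiv : (fun y => f y * sphLaplacian g y + sphInner f g y)
      = divergence fun y => f y • sphGrad g y := by
    funext y
    rw [divergence_smul (hf.differentiable one_ne_zero y) (hS.differentiable one_ne_zero y),
      sphInner, inner_gradient_left, sphLaplacian]
  rw [hdiv]
  exact sphIntegral_divergence_eq_zero (hf.smul hS)
    (fun y => by rw [real_inner_smul_right, inner_self_sphGrad, mul_zero]) hr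

end Green

/-! ### Scaling derivatives -/

section ScalingDeriv

variable {E : Type*} [NormedAddCommGroup E]

/-- `g = (y · ∇ + c) f`; equivalently, `g` is the scaling derivative of `f` with weight `c`, in
the sense that `t ↦ t ^ c f(tθ)` has derivative `t ^ (c - 1) g(tθ)`. -/
structure HasScalingDeriv [NormedSpace ℝ E] (c : ℝ) (f g : E → ℝ) : Prop where
  differentiable : Differentiable ℝ f
  euler_add_mul : ∀ y, euler f y + c * f y = g y

/-- `ladder c f j = (y · ∇ + c - (j - 1)) ⋯ (y · ∇ + c) f`, so that
`dʲ/dtʲ (t ^ c f(tθ)) = t ^ (c - j) (ladder c f j)(tθ)`. -/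
def ladder [NormedSpace ℝ E] (c : ℝ) (f : E → ℝ) : ℕ → E → ℝ
  | 0 => f
  | j + 1 => fun y => euler (ladder c f j) y + (c - j) * ladder c f j y

namespace HasScalingDeriv

section Algebra

variable [NormedSpace ℝ E] {a b c : ℝ} {f f' g g' : E → ℝ}

theorem add_weight (h : HasScalingDeriv c f f') (a : ℝ) :
    HasScalingDeriv (c + a) f fun y => f' y + a * f y :=
  ⟨h.differentiable, fun y => by rw [← h.euler_add_mul]; ring⟩

theorem add (hf : HasScalingDeriv c f f') (hg : HasScalingDeriv c g g') :
    HasScalingDeriv c (fun y => f y + g y) fun y => f' y + g' y :=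
  ⟨hf.differentiable.fun_add hg.differentiable, fun y => by
    rw [euler_add (hf.differentiable y) (hg.differentiable y), ← hf.euler_add_mul,
      ← hg.euler_add_mul]
    ring⟩

theorem mul (hf : HasScalingDeriv a f f') (hg : HasScalingDeriv b g g') :
    HasScalingDeriv (a + b) (fun y => f y * g y) fun y => f' y * g y + f y * g' y :=
  ⟨hf.differentiable.fun_mul hg.differentiable, fun y => by
    have h := euler_smul (hf.differentiable y) (hg.differentiable y)
    simp only [smul_eq_mul] at h
    rw [h, ← hf.euler_add_mul, ← hg.euler_add_mul]
    ring⟩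

theorem const_mul (hf : HasScalingDeriv c f f') (a : ℝ) :
    HasScalingDeriv c (fun y => a * f y) fun y => a * f' y :=
  ⟨hf.differentiable.const_mul a, fun y => by
    rw [← hf.euler_add_mul, euler_const_mul (hf.differentiable y)]
    ring⟩

end Algebra

variable [InnerProductSpace ℝ E] {a b c : ℝ} {f f' f'' g g' : E → ℝ}

theorem normSq_mul (hf : HasScalingDeriv c f f') :
    HasScalingDeriv (c - 2) (fun y => ‖y‖ ^ 2 * f y) fun y => ‖y‖ ^ 2 * f' y := by
  have hN : HasScalingDeriv (-2) (fun y : E => ‖y‖ ^ 2) fun _ => 0 :=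
    ⟨differentiable_normSq, fun y => by rw [euler_normSq]; ring⟩
  simpa [neg_add_eq_sub] using hN.mul hf

variable [FiniteDimensional ℝ E]

theorem laplacian (h : HasScalingDeriv c f f') (hf : ContDiff ℝ 3 f) :
    HasScalingDeriv (c + 2) (Δ f) (Δ f') := by
  have h2 : ContDiff ℝ 2 f := hf.of_le (by norm_num)
  have he : ContDiff ℝ 2 (euler f) := contDiff_euler hf (by norm_num)
  refine ⟨(contDiff_laplacian hf (m := 1) (by norm_num)).differentiable one_ne_zero, fun y => ?_⟩
  have hadd : (Δ fun z => euler f z + c * f z) y = (Δ (euler f)) y + (Δ fun z => c * f z) y :=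
    he.contDiffAt.laplacian_add (contDiff_const.mul h2).contDiffAt
  have hmul : (Δ fun z => c * f z) y = c * (Δ f) y :=
    InnerProductSpace.laplacian_smul c h2.contDiffAt
  rw [← funext h.euler_add_mul, hadd, hmul, laplacian_euler hf]
  ring

theorem sphLaplacian (h : HasScalingDeriv c f f') (hf : ContDiff ℝ 3 f) :
    HasScalingDeriv c (sphLaplacian f) (sphLaplacian f') := by
  have h2 : ContDiff ℝ 2 f := hf.of_le (by norm_num)
  refine ⟨(contDiff_sphLaplacian hf (m := 1) (by norm_num)).differentiable one_ne_zero,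
    fun y => ?_⟩
  rw [← funext h.euler_add_mul, sphLaplacian_add (contDiff_euler hf (by norm_num))
    (contDiff_const.mul h2), sphLaplacian_const_mul h2, euler_sphLaplacian hf]

theorem sphInner_eq (h : HasScalingDeriv c f f') (hf : ContDiff ℝ 2 f) (g : E → ℝ) (y : E) :
    sphInner (euler f) g y = sphInner f' g y - c * sphInner f g y := by
  have hd := hf.differentiable two_ne_zero
  have he : ContDiff ℝ 1 (euler f) := contDiff_euler hf (by norm_num)
  rw [← funext h.euler_add_mul, sphInner_add_left (he.differentiable one_ne_zero y)
    ((hd y).const_mul c), sphInner_const_mul_left (hd y), add_sub_cancel_right]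

theorem sphInner (hf : HasScalingDeriv a f f') (hg : HasScalingDeriv b g g')
    (hfc : ContDiff ℝ 2 f) (hgc : ContDiff ℝ 2 g) :
    HasScalingDeriv (a + b) (sphInner f g) fun y => sphInner f' g y + sphInner f g' y := by
  refine ⟨(contDiff_sphInner hfc hgc (m := 1) (by norm_num)).differentiable one_ne_zero,
    fun y => ?_⟩
  rw [euler_sphInner hfc hgc, hf.sphInner_eq hfc, sphInner_comm f (euler g),
    hg.sphInner_eq hgc, sphInner_comm g' f, sphInner_comm g f]
  ring

theorem normSq_mul_laplacian (h : HasScalingDeriv c f f') (h' : HasScalingDeriv c f' f'')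
    (hf : ContDiff ℝ 2 f) (y : E) :
    ‖y‖ ^ 2 * (Δ f) y = f'' y + (finrank ℝ E - 2 - 2 * c) * f' y
      + c * (c + 2 - finrank ℝ E) * f y + Triharmonic.sphLaplacian f y := by
  have he (z : E) : euler f z = f' z + -c * f z := by rw [← h.euler_add_mul]; ring
  have hee : euler (euler f) y = (f'' y - c * f' y) - c * (f' y - c * f y) := by
    have h2 := (h'.add (h.const_mul (-c))).euler_add_mul y
    rw [← funext he] at h2
    linear_combination h2
  rw [Triharmonic.normSq_mul_laplacian hf, hee, he]
  ring

end HasScalingDeriv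

section Ladder

variable [NormedSpace ℝ E] {f : E → ℝ}

theorem ladder_zero (c : ℝ) (f : E → ℝ) : ladder c f 0 = f := rfl

theorem contDiff_ladder (c : ℝ) (j : ℕ) {m N : WithTop ℕ∞} (hf : ContDiff ℝ N f) (h : m + j ≤ N) :
    ContDiff ℝ m (ladder c f j) := by
  induction j generalizing m with
  | zero => exact hf.of_le (by simpa using h)
  | succ j ih =>
    have hj : ContDiff ℝ (m + 1) (ladder c f j) :=
      ih (by rwa [add_assoc, add_comm (1 : WithTop ℕ∞), ← Nat.cast_add_one])
    exact (contDiff_euler hj le_rfl).add (contDiff_const.mul (hj.of_le (by simp)))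

theorem hasScalingDeriv_ladder (c : ℝ) (j : ℕ) {N : WithTop ℕ∞} (hf : ContDiff ℝ N f)
    (h : 1 + j ≤ N) : HasScalingDeriv (c - j) (ladder c f j) (ladder c f (j + 1)) :=
  ⟨(contDiff_ladder c j hf h).differentiable one_ne_zero, fun _ => rfl⟩

theorem hasScalingDeriv_ladder_one (c : ℝ) {N : WithTop ℕ∞} (hf : ContDiff ℝ N f) (h : 1 ≤ N) :
    HasScalingDeriv c f (ladder c f 1) := by
  simpa [ladder_zero] using hasScalingDeriv_ladder c 0 hf (by simpa using h)

theorem hasScalingDeriv_ladder_weight (c : ℝ) (j : ℕ) {N : WithTop ℕ∞} (hf : ContDiff ℝ N f)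
    (h : 1 + j ≤ N) :
    HasScalingDeriv c (ladder c f j) fun y => ladder c f (j + 1) y + j * ladder c f j y := by
  simpa using (hasScalingDeriv_ladder c j hf h).add_weight j

end Ladder

section Bilaplacian

variable [InnerProductSpace ℝ E] [FiniteDimensional ℝ E] {f : E → ℝ}

theorem normSq_mul_laplacian_ladder (c : ℝ) (hf : ContDiff ℝ 3 f) (y : E) :
    ‖y‖ ^ 2 * (Δ f) y = ladder c f 2 y + (finrank ℝ E - 1 - 2 * c) * ladder c f 1 y
      + c * (c + 2 - finrank ℝ E) * ladder c f 0 y + sphLaplacian (ladder c f 0) y := by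
  have h0 := hasScalingDeriv_ladder_weight c 0 hf (by norm_num)
  have h1 := hasScalingDeriv_ladder_weight c 1 hf (by norm_num)
  simp only [Nat.cast_zero, zero_mul, add_zero, zero_add, Nat.cast_one, one_mul] at h0 h1
  have h := h0.normSq_mul_laplacian h1 (hf.of_le (by norm_num)) y
  rw [ladder_zero] at h ⊢
  linear_combination h

theorem normSq_mul_sphLaplacian_laplacian_ladder (c : ℝ) (hf : ContDiff ℝ 4 f) (y : E) :
    ‖y‖ ^ 2 * sphLaplacian (Δ f) y
      = sphLaplacian (ladder c f 2) y + (finrank ℝ E - 1 - 2 * c) * sphLaplacian (ladder c f 1) y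
        + c * (c + 2 - finrank ℝ E) * sphLaplacian (ladder c f 0) y
        + sphLaplacian (sphLaplacian (ladder c f 0)) y := by
  have hS : ContDiff ℝ 2 (sphLaplacian (ladder c f 0)) := contDiff_sphLaplacian hf (by norm_num)
  have h0 : ContDiff ℝ 2 (ladder c f 0) := contDiff_ladder c 0 hf (by norm_num)
  have h1 : ContDiff ℝ 2 (ladder c f 1) := contDiff_ladder c 1 hf (by norm_num)
  have h2 : ContDiff ℝ 2 (ladder c f 2) := contDiff_ladder c 2 hf (by norm_num)
  rw [← sphLaplacian_normSq_mul (contDiff_laplacian hf (by norm_num)),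
    funext (normSq_mul_laplacian_ladder c (hf.of_le (by norm_num))),
    sphLaplacian_add ((h2.add (contDiff_const.mul h1)).add (contDiff_const.mul h0)) hS,
    sphLaplacian_add (h2.add (contDiff_const.mul h1)) (contDiff_const.mul h0),
    sphLaplacian_add h2 (contDiff_const.mul h1), sphLaplacian_const_mul h1,
    sphLaplacian_const_mul h0]

theorem norm_pow_mul_bilaplacian (c : ℝ) (hf : ContDiff ℝ 6 f) (y : E) :
    ‖y‖ ^ 4 * (Δ (Δ f)) y
      = ladder c f 4 y
        + (2 * (finrank ℝ E - 1) - 4 * c) * ladder c f 3 y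
        + (6 * c * (1 + c) - 6 * (finrank ℝ E - 1) * c + (finrank ℝ E - 1) * (finrank ℝ E - 3))
          * ladder c f 2 y
        + (-4 * c * (1 + c) * (2 + c) + 6 * (finrank ℝ E - 1) * c * (1 + c)
          - (finrank ℝ E - 1) * (finrank ℝ E - 3) * (1 + 2 * c)) * ladder c f 1 y
        + (c * (1 + c) * (2 + c) * (3 + c) - 2 * (finrank ℝ E - 1) * c * (1 + c) * (2 + c)
          + (finrank ℝ E - 1) * (finrank ℝ E - 3) * c * (2 + c)) * ladder c f 0 y
        + 2 * sphLaplacian (ladder c f 2) y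
        + 2 * (finrank ℝ E - 3 - 2 * c) * sphLaplacian (ladder c f 1) y
        + 2 * (c * (4 + c - finrank ℝ E) - finrank ℝ E + 4) * sphLaplacian (ladder c f 0) y
        + sphLaplacian (sphLaplacian (ladder c f 0)) y := by
  have C1 : ContDiff ℝ 5 (ladder c f 1) := contDiff_ladder c 1 hf (by norm_num)
  have C2 : ContDiff ℝ 4 (ladder c f 2) := contDiff_ladder c 2 hf (by norm_num)
  have C1' : ContDiff ℝ 2 (ladder c f 1) := C1.of_le (by norm_num)
  have C2' : ContDiff ℝ 2 (ladder c f 2) := C2.of_le (by norm_num)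
  -- the iterates of `y · ∇ + c` on `f` are `L₀`, `L₁`, `L₂ + L₁`, `L₃ + 3 L₂ + L₁`, …
  have h0 := hasScalingDeriv_ladder_weight c 0 hf (by norm_num)
  have h1 := hasScalingDeriv_ladder_weight c 1 hf (by norm_num)
  have h2 := hasScalingDeriv_ladder_weight c 2 hf (by norm_num)
  have h3 := hasScalingDeriv_ladder_weight c 3 hf (by norm_num)
  simp only [Nat.cast_zero, zero_mul, add_zero, zero_add, Nat.cast_one, one_mul] at h0 h1
  have h21 := h2.add h1
  have h321 := (h3.add (h2.const_mul 2)).add h21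
  have hΔ0 := h0.laplacian (hf.of_le (by norm_num))
  have hΔ1 := h1.laplacian (C1.of_le (by norm_num))
  linear_combination (norm := skip)
    ‖y‖ ^ 2 * hΔ0.normSq_mul_laplacian hΔ1 (contDiff_laplacian hf (by norm_num)) y
    + normSq_mul_sphLaplacian_laplacian_ladder c (hf.of_le (by norm_num)) y
    + h21.normSq_mul_laplacian h321 (C2'.add C1') y
    + (finrank ℝ E - 6 - 2 * c) * h1.normSq_mul_laplacian h21 C1' y
    + (c + 2) * (c + 4 - finrank ℝ E) * normSq_mul_laplacian_ladder c (hf.of_le (by norm_num)) y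
  rw [sphLaplacian_add C2' C1']
  simp only [ladder_zero]
  ring_nf

end Bilaplacian

end ScalingDeriv

section SphLadder

variable {E : Type*} [NormedAddCommGroup E] [InnerProductSpace ℝ E] [FiniteDimensional ℝ E]
  {f : E → ℝ} {N : WithTop ℕ∞}

theorem contDiff_sphLaplacian_ladder (c : ℝ) (j : ℕ) {m : WithTop ℕ∞} (hf : ContDiff ℝ N f)
    (h : m + 2 + j ≤ N) : ContDiff ℝ m (sphLaplacian (ladder c f j)) :=
  contDiff_sphLaplacian (contDiff_ladder c j hf h) le_rfl

theorem contDiff_sphInner_ladder (c : ℝ) (i j : ℕ) {m : WithTop ℕ∞} (hf : ContDiff ℝ N f)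
    (hi : m + 1 + i ≤ N) (hj : m + 1 + j ≤ N) :
    ContDiff ℝ m (sphInner (ladder c f i) (ladder c f j)) :=
  contDiff_sphInner (contDiff_ladder c i hf hi) (contDiff_ladder c j hf hj) le_rfl

theorem hasScalingDeriv_sphLaplacian_ladder (c : ℝ) (j : ℕ) (hf : ContDiff ℝ N f)
    (h : 3 + j ≤ N) :
    HasScalingDeriv c (sphLaplacian (ladder c f j))
      fun y => sphLaplacian (ladder c f (j + 1)) y + j * sphLaplacian (ladder c f j) y := by
  simpa using ((hasScalingDeriv_ladder c j hf (le_trans (by gcongr; norm_num) h)).sphLaplacian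
    (contDiff_ladder c j hf h)).add_weight j

theorem hasScalingDeriv_sphInner_ladder (c : ℝ) (i j : ℕ) (hf : ContDiff ℝ N f)
    (hi : 2 + i ≤ N) (hj : 2 + j ≤ N) :
    HasScalingDeriv (c + c) (sphInner (ladder c f i) (ladder c f j)) fun y =>
      sphInner (ladder c f (i + 1)) (ladder c f j) y
        + sphInner (ladder c f i) (ladder c f (j + 1)) y
        + (i + j) * sphInner (ladder c f i) (ladder c f j) y := by
  have h := ((hasScalingDeriv_ladder c i hf (le_trans (by gcongr; norm_num) hi)).sphInner
    (hasScalingDeriv_ladder c j hf (le_trans (by gcongr; norm_num) hj))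
    (contDiff_ladder c i hf hi) (contDiff_ladder c j hf hj)).add_weight (i + j)
  rwa [show c - i + (c - j) + (i + j : ℝ) = c + c by ring] at h

theorem hasScalingDeriv_sphLaplacian_sq (c : ℝ) (hf : ContDiff ℝ 3 f) :
    HasScalingDeriv (2 * c) (fun y => sphLaplacian f y * sphLaplacian f y)
      fun y => 2 * (sphLaplacian f y * sphLaplacian (ladder c f 1) y) := by
  have h := (hasScalingDeriv_ladder_one c hf (by norm_num)).sphLaplacian hf
  convert h.mul h using 1
  · ring
  · funext y
    ring

theorem hasScalingDeriv_sphInner_self (c : ℝ) (j : ℕ) (hf : ContDiff ℝ N f) (hj : 2 + j ≤ N) :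
    HasScalingDeriv (2 * (c - j)) (sphInner (ladder c f j) (ladder c f j))
      fun y => 2 * sphInner (ladder c f j) (ladder c f (j + 1)) y := by
  have hl := contDiff_ladder c j hf hj
  have h := hasScalingDeriv_ladder c j hf (le_trans (by gcongr; norm_num) hj)
  convert h.sphInner h hl hl using 1
  · ring
  · funext y
    rw [sphInner_comm (ladder c f (j + 1))]
    ring

end SphLadder

/-! ### The bulk energy -/

theorem kappa_mul_sub_one {p : ℝ} (hp : 1 < p) : kappa p * (p - 1) = 6 := by
  rw [kappa, div_mul_cancel₀]
  linarith

theorem abs_rpow_add_one {p : ℝ} (hp : 1 < p) (a : ℝ) :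
    |a| ^ (p + 1) = |a| ^ (p - 1) * a * a := by
  rcases eq_or_ne a 0 with rfl | ha
  · rw [abs_zero, Real.zero_rpow (by linarith), mul_zero]
  · rw [show p + 1 = (p - 1) + 2 by ring, Real.rpow_add (abs_pos.2 ha), Real.rpow_two, sq_abs]
    ring

theorem hasFDerivAt_abs_rpow_add_one {E : Type*} [NormedAddCommGroup E] [NormedSpace ℝ E]
    {U : E → ℝ} {y : E} {p : ℝ} (hp : 1 < p) (hU : DifferentiableAt ℝ U y) :
    HasFDerivAt (fun z => |U z| ^ (p + 1))
      (((p + 1) * (|U y| ^ (p - 1) * U y)) • fderiv ℝ U y) y := by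
  have h := (hasDerivAt_abs_rpow (U y) (by linarith : 1 < p + 1)).comp_hasFDerivAt y
    hU.hasFDerivAt
  rw [show p + 1 - 2 = p - 1 by ring, mul_assoc] at h
  exact h

section Bulk

variable {E : Type*} [NormedAddCommGroup E] [InnerProductSpace ℝ E] [FiniteDimensional ℝ E]
  {U f g h v w : E → ℝ} {X : E → E} {p R : ℝ}

theorem divergence_smul_gradient (hf : ContDiff ℝ 1 f) (hg : ContDiff ℝ 2 g) (y : E) :
    divergence (fun z => f z • ∇ g z) y = f y * (Δ g) y + inner ℝ (∇ f y) (∇ g y) := by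
  have hG : ContDiff ℝ 1 (∇ g) := contDiff_gradient hg (by norm_num)
  rw [divergence_smul (hf.differentiable one_ne_zero y) (hG.differentiable one_ne_zero y),
    laplacian_eq_divergence_gradient hg, inner_gradient_left]

/-- The vector field of Green's formula for the bilaplacian: its divergence trades `w Δ²v` for
`-∇(Δw) · ∇v`. -/
def greenField (w v : E → ℝ) (y : E) : E :=
  (Δ w) y • ∇ v y - (Δ v) y • ∇ w y + w y • ∇ (Δ v) y

theorem inner_self_greenField (w v : E → ℝ) (y : E) :
    inner ℝ y (greenField w v y)
      = (Δ w) y * euler v y - (Δ v) y * euler w y + w y * euler (Δ v) y := by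
  simp only [greenField, inner_add_right, inner_sub_right, real_inner_smul_right,
    inner_self_gradient]

theorem contDiff_greenField (hw : ContDiff ℝ 3 w) (hv : ContDiff ℝ 4 v) :
    ContDiff ℝ 1 (greenField w v) := by
  have hΔv : ContDiff ℝ 2 (Δ v) := contDiff_laplacian hv (by norm_num)
  exact (((contDiff_laplacian hw (by norm_num)).smul (contDiff_gradient hv (by norm_num))).sub
    ((hΔv.of_le (by norm_num)).smul (contDiff_gradient hw (by norm_num)))).add
    ((hw.of_le (by norm_num)).smul (contDiff_gradient hΔv (by norm_num)))

theorem divergence_greenField (hw : ContDiff ℝ 3 w) (hv : ContDiff ℝ 4 v) (y : E) :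
    divergence (greenField w v) y = inner ℝ (∇ (Δ w) y) (∇ v y) + w y * (Δ (Δ v)) y := by
  have hΔw : ContDiff ℝ 1 (Δ w) := contDiff_laplacian hw (by norm_num)
  have hΔv : ContDiff ℝ 2 (Δ v) := contDiff_laplacian hv (by norm_num)
  have hd {f g : E → ℝ} (hf : ContDiff ℝ 1 f) (hg : ContDiff ℝ 2 g) :
      DifferentiableAt ℝ (fun z => f z • ∇ g z) y :=
    (hf.smul (contDiff_gradient hg (by norm_num))).differentiable one_ne_zero y
  have hw2 : ContDiff ℝ 2 w := hw.of_le (by norm_num)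
  have hw1 : ContDiff ℝ 1 w := hw.of_le (by norm_num)
  have hv2 : ContDiff ℝ 2 v := hv.of_le (by norm_num)
  have hΔv1 : ContDiff ℝ 1 (Δ v) := hΔv.of_le (by norm_num)
  change divergence (fun z => (Δ w) z • ∇ v z - (Δ v) z • ∇ w z + w z • ∇ (Δ v) z) y = _
  rw [divergence_add ((hd hΔw hv2).fun_sub (hd hΔv1 hw2)) (hd hw1 hΔv),
    divergence_sub (hd hΔw hv2) (hd hΔv1 hw2), divergence_smul_gradient hΔw hv2,
    divergence_smul_gradient hΔv1 hw2, divergence_smul_gradient hw1 hΔv,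
    real_inner_comm (∇ w y)]
  ring

/-- The density of the bulk energy. -/
def bulkDensity (p : ℝ) (U : E → ℝ) (y : E) : ℝ :=
  1 / 2 * ‖∇ (Δ U) y‖ ^ 2 - 1 / (p + 1) * |U y| ^ (p + 1)

theorem contDiff_bulkDensity (hp : 1 < p) (hU : ContDiff ℝ 4 U) :
    ContDiff ℝ 1 (bulkDensity p U) := by
  have hv : ContDiff ℝ 2 (Δ U) := contDiff_laplacian hU (by norm_num)
  exact (contDiff_const.mul ((contDiff_gradient hv (by norm_num)).norm_sq ℝ)).sub
    (contDiff_const.mul ((contDiff_norm_rpow (by linarith : 1 < p + 1)).comp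
      (hU.of_le (by norm_num))))

theorem euler_bulkDensity (hp : 1 < p) (hU : ContDiff ℝ 4 U) (y : E) :
    euler (bulkDensity p U) y = inner ℝ (∇ (Δ U) y) (∇ (euler (Δ U)) y - ∇ (Δ U) y)
      - |U y| ^ (p - 1) * U y * euler U y := by
  have hv : ContDiff ℝ 2 (Δ U) := contDiff_laplacian hU (by norm_num)
  have hG : DifferentiableAt ℝ (∇ (Δ U)) y :=
    (contDiff_gradient hv (m := 1) (by norm_num)).differentiable one_ne_zero y
  have hpow := hasFDerivAt_abs_rpow_add_one hp (hU.differentiable four_ne_zero y)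
  have hsq : euler (fun z => ‖∇ (Δ U) z‖ ^ 2) y
      = 2 * inner ℝ (∇ (Δ U) y) (euler (∇ (Δ U)) y) := by
    simp only [← real_inner_self_eq_norm_sq]
    rw [euler_inner hG hG, real_inner_comm]
    ring
  have hrp : euler (fun z => |U z| ^ (p + 1)) y
      = (p + 1) * (|U y| ^ (p - 1) * U y) * euler U y := by
    rw [euler, hpow.fderiv]
    rfl
  have hp1 : p + 1 ≠ 0 := by linarith
  change euler (fun z => 1 / 2 * ‖∇ (Δ U) z‖ ^ 2 - 1 / (p + 1) * |U z| ^ (p + 1)) y = _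
  rw [euler_sub ((hG.norm_sq ℝ).const_mul _) (hpow.differentiableAt.const_mul _),
    euler_const_mul (hG.norm_sq ℝ), euler_const_mul hpow.differentiableAt, hsq, hrp,
    gradient_euler hv, add_sub_cancel_right]
  field_simp

theorem gradient_laplacian_ladder_one (c : ℝ) (hU : ContDiff ℝ 4 U) (y : E) :
    ∇ (Δ (ladder c U 1)) y = ∇ (euler (Δ U)) y + (c + 2) • ∇ (Δ U) y := by
  have hv : ContDiff ℝ 2 (Δ U) := contDiff_laplacian hU (by norm_num)
  have hvd : DifferentiableAt ℝ (Δ U) y := hv.differentiable two_ne_zero y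
  have he : DifferentiableAt ℝ (euler (Δ U)) y :=
    (contDiff_euler hv (m := 1) (by norm_num)).differentiable one_ne_zero y
  rw [← funext ((hasScalingDeriv_ladder_one c hU (by norm_num)).laplacian
    (hU.of_le (by norm_num))).euler_add_mul, gradient_add he (hvd.const_mul _),
    gradient_const_mul hvd]

theorem divergence_greenField_ladder (hp : 1 < p) (hU : ContDiff ℝ 6 U)
    (heq : ∀ y, -(Δ (Δ (Δ U))) y = |U y| ^ (p - 1) * U y) (y : E) :
    divergence (greenField (ladder (kappa p) U 1) (Δ U)) y
      = (2 * kappa p + 6 - finrank ℝ E) * bulkDensity p U y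
        + divergence (fun z => bulkDensity p U z • z) y := by
  have hU4 : ContDiff ℝ 4 U := hU.of_le (by norm_num)
  have hp1 : p + 1 ≠ 0 := by linarith
  have hk : (2 * kappa p + 6) * (1 / (p + 1)) = kappa p := by
    field_simp
    linarith [kappa_mul_sub_one hp]
  rw [divergence_greenField (contDiff_ladder _ 1 hU (by norm_num))
      (contDiff_laplacian hU (by norm_num)),
    divergence_smul_id ((contDiff_bulkDensity hp hU4).differentiable one_ne_zero y),
    euler_bulkDensity hp hU4, gradient_laplacian_ladder_one _ hU4,
    ← (hasScalingDeriv_ladder_one _ hU (by norm_num)).euler_add_mul, neg_eq_iff_eq_neg.1 (heq y),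
    bulkDensity, abs_rpow_add_one hp, inner_add_left, inner_sub_right, real_inner_smul_left,
    real_inner_self_eq_norm_sq, real_inner_comm]
  linear_combination (|U y| ^ (p - 1) * U y * U y) * hk

variable [MeasurableSpace E] [BorelSpace E] [Nontrivial E]

theorem hasDerivAt_rpow_mul_integral_ball {e : ℝ} (hh : ContDiff ℝ 1 h) (hX : ContDiff ℝ 1 X)
    (hdiv : ∀ y, divergence X y = e * h y + divergence (fun z => h z • z) y) (hR : 0 < R) :
    HasDerivAt (fun t : ℝ => t ^ e * ∫ y in Metric.ball 0 t, h y)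
      (R ^ (e - 1) * flux X R) R := by
  refine ((Real.hasDerivAt_rpow_const (p := e) (Or.inl hR.ne')).mul
    (hasDerivAt_integral_ball hh.continuous hR)).congr_deriv ?_
  have hY : ContDiff ℝ 1 fun z => h z • z := hh.smul contDiff_id
  have hint {g : E → ℝ} (hg : Continuous g) : IntegrableOn g (Metric.ball 0 R) :=
    (hg.continuousOn.integrableOn_compact (isCompact_closedBall 0 R)).mono_set
      Metric.ball_subset_closedBall
  have hflux : flux (fun z => h z • z) R = R * (R ^ (finrank ℝ E - 1) * sphIntegral h R) := by
    rw [flux_eq_sphIntegral _ hR.ne', sphIntegral_congr hR.le (g := fun y => R ^ 2 * h y),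
      sphIntegral_const_mul]
    · field_simp
    · rintro y rfl
      rw [real_inner_smul_right, real_inner_self_eq_norm_sq, mul_comm]
  have hpow : R ^ e = R ^ (e - 1) * R := by rw [← Real.rpow_add_one hR.ne', sub_add_cancel]
  rw [← integral_ball_divergence hX hR.le]
  simp_rw [hdiv]
  rw [integral_add ((hint hh.continuous).const_mul _) (hint (continuous_divergence hY)),
    integral_const_mul, integral_ball_divergence hY hR.le, hflux, hpow]
  ring

theorem hasDerivAt_bulk (hp : 1 < p) (hU : ContDiff ℝ 6 U)
    (heq : ∀ y, -(Δ (Δ (Δ U))) y = |U y| ^ (p - 1) * U y) (hR : 0 < R) :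
    HasDerivAt
      (fun t : ℝ => t ^ (2 * kappa p + 6 - finrank ℝ E) * ∫ y in Metric.ball 0 t, bulkDensity p U y)
      (R ^ (2 * kappa p - 1) * (R ^ 4 *
        sphIntegral (fun y => inner ℝ y (greenField (ladder (kappa p) U 1) (Δ U) y)) R)) R := by
  refine (hasDerivAt_rpow_mul_integral_ball (contDiff_bulkDensity hp (hU.of_le (by norm_num)))
    (contDiff_greenField (contDiff_ladder _ 1 hU (by norm_num))
      (contDiff_laplacian hU (by norm_num)))
    (divergence_greenField_ladder hp hU heq) hR).congr_deriv ?_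
  have hpow : R ^ (2 * kappa p + 6 - finrank ℝ E - 1) * (R ^ (finrank ℝ E - 1) * R⁻¹)
      = R ^ (2 * kappa p - 1) * R ^ 4 := by
    rw [← Real.rpow_natCast, ← Real.rpow_natCast, ← Real.rpow_neg_one, ← Real.rpow_add hR,
      ← Real.rpow_add hR, ← Real.rpow_add hR, Nat.cast_sub finrank_pos]
    congr 1
    push_cast
    ring
  rw [flux_eq_sphIntegral _ hR.ne', ← mul_assoc (R ^ (2 * kappa p - 1)), ← hpow]
  ring

end Bulk

/-! ### The balance of boundary terms -/

section SphNull

variable {E : Type*} [NormedAddCommGroup E] [InnerProductSpace ℝ E] [FiniteDimensional ℝ E]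
  [MeasurableSpace E] [BorelSpace E] {f g Q : E → ℝ} {r : ℝ}

/-- The continuous functions whose integral over the sphere of radius `r` vanishes. -/
def sphNull (E : Type*) [NormedAddCommGroup E] [InnerProductSpace ℝ E] [FiniteDimensional ℝ E]
    [MeasurableSpace E] [BorelSpace E] (r : ℝ) : Submodule ℝ (E → ℝ) where
  carrier := {f | Continuous f ∧ sphIntegral f r = 0}
  zero_mem' := ⟨continuous_const, by simp [sphIntegral]⟩
  add_mem' := fun ⟨hf, hf0⟩ ⟨hg, hg0⟩ =>
    ⟨hf.add hg, (sphIntegral_add hf hg r).trans (by rw [hf0, hg0, add_zero])⟩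
  smul_mem' := fun c f ⟨hf, hf0⟩ =>
    ⟨hf.const_smul c, (sphIntegral_const_mul c f r).trans (by rw [hf0, mul_zero])⟩

theorem mul_sphLaplacian_add_sphInner_mem_sphNull [Nontrivial E] (hf : ContDiff ℝ 2 f)
    (hg : ContDiff ℝ 2 g) (hr : 0 < r) (c : ℝ) :
    (fun y => c * (f y * sphLaplacian g y + sphInner f g y)) ∈ sphNull E r :=
  (sphNull E r).smul_mem c
    ⟨(hf.continuous.mul (contDiff_sphLaplacian hg (m := 0) (by norm_num)).continuous).add
      (contDiff_sphInner hf hg (m := 1) (by norm_num)).continuous,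
    sphIntegral_mul_sphLaplacian_add_sphInner (hf.of_le (by norm_num)) hg hr⟩

theorem hasDerivAt_rpow_mul_sphIntegral (hQ : ContDiff ℝ 1 Q) (c : ℝ) (hr : 0 < r) :
    HasDerivAt (fun t : ℝ => t ^ c * sphIntegral Q t)
      (r ^ (c - 1) * sphIntegral (fun y => euler Q y + c * Q y) r) r := by
  refine ((Real.hasDerivAt_rpow_const (p := c) (Or.inl hr.ne')).mul
    (hasDerivAt_sphIntegral hQ hr.ne')).congr_deriv ?_
  have hpow : r ^ c = r ^ (c - 1) * r := by rw [← Real.rpow_add_one hr.ne', sub_add_cancel]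
  have hcQ : Continuous fun y => c * Q y := continuous_const.mul hQ.continuous
  rw [sphIntegral_add (continuous_euler hQ) hcQ, sphIntegral_const_mul, hpow]
  field_simp
  ring

end SphNull

theorem inner_self_greenField_ladder {E : Type*} [NormedAddCommGroup E] [InnerProductSpace ℝ E]
    [FiniteDimensional ℝ E] {U : E → ℝ} (c : ℝ) (hU : ContDiff ℝ 5 U) (y : E) :
    inner ℝ y (greenField (ladder c U 1) (Δ U) y)
      = (Δ (ladder c U 1)) y ^ 2 - (c + 2) * ((Δ U) y * (Δ (ladder c U 1)) y)
        + ladder c U 1 y * (Δ (Δ (ladder c U 1))) y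
        - (ladder c U 2 y + 5 * ladder c U 1 y) * (Δ (Δ U)) y := by
  have hΔ := (hasScalingDeriv_ladder_one c hU (by norm_num)).laplacian (hU.of_le (by norm_num))
  have hΔΔ := hΔ.laplacian (contDiff_laplacian hU (by norm_num))
  have h1 := hasScalingDeriv_ladder_weight c 1 hU (by norm_num)
  rw [inner_self_greenField]
  linear_combination (Δ (ladder c U 1)) y * hΔ.euler_add_mul y
    + ladder c U 1 y * hΔΔ.euler_add_mul y - (Δ (Δ U)) y * h1.euler_add_mul y

section Balance

variable {n : ℕ} (p : ℝ) (U : Space n → ℝ)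

local notation "W" => ladder (kappa p) U

/-- The part of `‖y‖⁴ Δ²U` without angular derivatives. -/
def radialBilaplacian (y : Space n) : ℝ :=
  W 4 y + delta1 n p * W 3 y + delta2 n p * W 2 y + delta3 n p * W 1 y + delta4 n p * W 0 y

/-- The part of `‖y‖⁴ Δ²U` with angular derivatives. -/
def angularBilaplacian (y : Space n) : ℝ :=
  2 * sphLaplacian (W 2) y + 2 * alpha n p * sphLaplacian (W 1) y
    + 2 * (beta n p - n + 4) * sphLaplacian (W 0) y + sphLaplacian (sphLaplacian (W 0)) y

/-- The part of the boundary energy density without angular derivatives, apart from `(Δu)²`. -/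
def radialDensity (y : Space n) : ℝ :=
  -1 * (W 4 y * W 1 y) + 2 * (W 3 y * W 2 y) + -(delta1 n p - 6) * (W 3 y * W 1 y)
    + -(24 - 6 * delta1 n p + delta2 n p) * (W 2 y * W 1 y)
    + -(9 * delta1 n p - 3 * delta2 n p - 36) * (W 1 y * W 1 y)
    + (delta1 n p - 8) * (W 2 y * W 2 y) + delta4 n p * (W 1 y * W 0 y)
    + 2 * delta4 n p * (W 0 y * W 0 y)

/-- The part of the boundary energy density with angular derivatives. -/
def angularDensity (y : Space n) : ℝ :=
  2 * (sphLaplacian (W 0) y * sphLaplacian (W 0) y)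
    + 1 * (sphLaplacian (W 0) y * sphLaplacian (W 1) y)
    + -4 * (beta n p - n + 4) * sphInner (W 0) (W 0) y
    + -2 * (beta n p - n + 4) * sphInner (W 0) (W 1) y
    + -6 * sphInner (W 1) (W 1) y + 2 * sphInner (W 1) (W 2) y

/-- The density of the boundary part of the energy: `t ^ (2κ)` times its integral over the unit
sphere scaled by `t` is the sum of the surface integrals in `energy`. -/
def boundaryDensity (y : Space n) : ℝ :=
  radialDensity p U y + 1 / 2 * (kappa p + 2) * (‖y‖ ^ 2 * (Δ U) y * (‖y‖ ^ 2 * (Δ U) y))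
    + angularDensity p U y

/-- The part of `dissipation` without angular derivatives, apart from `(Δu)²`. -/
def radialDissipation (y : Space n) : ℝ :=
  2 * W 3 y ^ 2 + (10 * delta1 n p - 2 * delta2 n p - 56) * W 2 y ^ 2
    + (-18 * delta1 n p + 6 * delta2 n p - 4 * delta3 n p + 2 * delta4 n p + 72) * W 1 y ^ 2

/-- The part of `dissipation` with angular derivatives. -/
def angularDissipation (y : Space n) : ℝ :=
  4 * sphInner (W 2) (W 2) y
    + (8 * alpha n p - 4 * beta n p + 4 * n - 28) * sphInner (W 1) (W 1) y
    + 2 * sphLaplacian (W 1) y ^ 2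

/-- The density of the derivative of the energy. -/
def dissipation (y : Space n) : ℝ :=
  radialDissipation p U y + angularDissipation p U y + (‖y‖ ^ 2 * (Δ (W 1)) y) ^ 2

variable {p U}

theorem contDiff_radialBilaplacian (hU : ContDiff ℝ 6 U) :
    ContDiff ℝ 1 (radialBilaplacian p U) := by
  have hW (j : ℕ) (hj : (1 + j : WithTop ℕ∞) ≤ 6) : ContDiff ℝ 1 (W j) :=
    contDiff_ladder _ j hU hj
  have h0 := hW 0 (by norm_num)
  have h1 := hW 1 (by norm_num)
  have h2 := hW 2 (by norm_num)
  have h3 := hW 3 (by norm_num)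
  have h4 := hW 4 (by norm_num)
  unfold radialBilaplacian
  fun_prop

theorem radial_balance (hU : ContDiff ℝ 6 U) (y : Space n) :
    (euler (radialDensity p U) y + 2 * kappa p * radialDensity p U y)
      + W 1 y * (euler (radialBilaplacian p U) y + kappa p * radialBilaplacian p U y)
      - (W 2 y + 5 * W 1 y) * radialBilaplacian p U y
      = radialDissipation p U y := by
  have h0 := hasScalingDeriv_ladder_weight (kappa p) 0 hU (by norm_num)
  have h1 := hasScalingDeriv_ladder_weight (kappa p) 1 hU (by norm_num)
  have h2 := hasScalingDeriv_ladder_weight (kappa p) 2 hU (by norm_num)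
  have h3 := hasScalingDeriv_ladder_weight (kappa p) 3 hU (by norm_num)
  have h4 := hasScalingDeriv_ladder_weight (kappa p) 4 hU (by norm_num)
  have hZ : euler (radialBilaplacian p U) y + kappa p * radialBilaplacian p U y = _ :=
    ((((h4.add (h3.const_mul (delta1 n p))).add (h2.const_mul (delta2 n p))).add
      (h1.const_mul (delta3 n p))).add (h0.const_mul (delta4 n p))).euler_add_mul y
  have hQ : euler (radialDensity p U) y + (kappa p + kappa p) * radialDensity p U y = _ :=
    ((((((((h4.mul h1).const_mul (-1)).add ((h3.mul h2).const_mul 2)).add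
      ((h3.mul h1).const_mul (-(delta1 n p - 6)))).add
      ((h2.mul h1).const_mul (-(24 - 6 * delta1 n p + delta2 n p)))).add
      ((h1.mul h1).const_mul (-(9 * delta1 n p - 3 * delta2 n p - 36)))).add
      ((h2.mul h2).const_mul (delta1 n p - 8))).add ((h1.mul h0).const_mul (delta4 n p))).add
      ((h0.mul h0).const_mul (2 * delta4 n p)) |>.euler_add_mul y
  rw [two_mul, hQ, hZ, radialBilaplacian, radialDissipation]
  push_cast
  ring

theorem contDiff_angularBilaplacian (hU : ContDiff ℝ 6 U) :
    ContDiff ℝ 1 (angularBilaplacian p U) := by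
  have h0 : ContDiff ℝ 3 (sphLaplacian (W 0)) :=
    contDiff_sphLaplacian_ladder _ 0 hU (by norm_num)
  have h0' : ContDiff ℝ 1 (sphLaplacian (W 0)) := h0.of_le (by norm_num)
  have h1 : ContDiff ℝ 1 (sphLaplacian (W 1)) :=
    contDiff_sphLaplacian_ladder _ 1 hU (by norm_num)
  have h2 : ContDiff ℝ 1 (sphLaplacian (W 2)) :=
    contDiff_sphLaplacian_ladder _ 2 hU (by norm_num)
  have h00 : ContDiff ℝ 1 (sphLaplacian (sphLaplacian (W 0))) :=
    contDiff_sphLaplacian h0 (by norm_num)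
  unfold angularBilaplacian
  fun_prop

theorem euler_angularBilaplacian (hU : ContDiff ℝ 6 U) (y : Space n) :
    euler (angularBilaplacian p U) y + kappa p * angularBilaplacian p U y
      = 2 * sphLaplacian (W 3) y + (4 + 2 * alpha n p) * sphLaplacian (W 2) y
        + 2 * (alpha n p + beta n p - n + 4) * sphLaplacian (W 1) y
        + sphLaplacian (sphLaplacian (W 1)) y := by
  have hS0 := hasScalingDeriv_sphLaplacian_ladder (kappa p) 0 hU (by norm_num)
  have hS1 := hasScalingDeriv_sphLaplacian_ladder (kappa p) 1 hU (by norm_num)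
  have hS2 := hasScalingDeriv_sphLaplacian_ladder (kappa p) 2 hU (by norm_num)
  have hSS0 := ((hasScalingDeriv_ladder_one (kappa p) hU (by norm_num)).sphLaplacian
    (hU.of_le (by norm_num))).sphLaplacian (contDiff_sphLaplacian hU (by norm_num))
  have hZ : euler (angularBilaplacian p U) y + kappa p * angularBilaplacian p U y = _ :=
    ((((hS2.const_mul 2).add (hS1.const_mul (2 * alpha n p))).add
      (hS0.const_mul (2 * (beta n p - n + 4)))).add hSS0).euler_add_mul y
  rw [hZ]
  push_cast
  ring

theorem euler_angularDensity (hU : ContDiff ℝ 6 U) (y : Space n) :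
    euler (angularDensity p U) y + 2 * kappa p * angularDensity p U y
      = 5 * (sphLaplacian (W 0) y * sphLaplacian (W 1) y) + sphLaplacian (W 1) y ^ 2
        + sphLaplacian (W 0) y * sphLaplacian (W 2) y
        - (beta n p - n + 4) * (10 * sphInner (W 0) (W 1) y + 2 * sphInner (W 1) (W 1) y
          + 2 * sphInner (W 0) (W 2) y)
        - 12 * sphInner (W 1) (W 1) y - 6 * sphInner (W 1) (W 2) y
        + 2 * sphInner (W 2) (W 2) y + 2 * sphInner (W 1) (W 3) y := by
  have hS0 := hasScalingDeriv_sphLaplacian_ladder (kappa p) 0 hU (by norm_num)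
  have hS1 := hasScalingDeriv_sphLaplacian_ladder (kappa p) 1 hU (by norm_num)
  have hI00 := hasScalingDeriv_sphInner_ladder (kappa p) 0 0 hU (by norm_num) (by norm_num)
  have hI01 := hasScalingDeriv_sphInner_ladder (kappa p) 0 1 hU (by norm_num) (by norm_num)
  have hI11 := hasScalingDeriv_sphInner_ladder (kappa p) 1 1 hU (by norm_num) (by norm_num)
  have hI12 := hasScalingDeriv_sphInner_ladder (kappa p) 1 2 hU (by norm_num) (by norm_num)
  have hA : euler (angularDensity p U) y + (kappa p + kappa p) * angularDensity p U y = _ :=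
    ((((((hS0.mul hS0).const_mul 2).add ((hS0.mul hS1).const_mul 1)).add
      (hI00.const_mul (-4 * (beta n p - n + 4)))).add
      (hI01.const_mul (-2 * (beta n p - n + 4)))).add (hI11.const_mul (-6))).add
      (hI12.const_mul 2) |>.euler_add_mul y
  rw [two_mul, hA]
  simp only [sphInner_comm (W 2) (W 1), sphInner_comm (W 1) (W 0)]
  push_cast
  ring

theorem angular_balance [Nontrivial (Space n)] (hU : ContDiff ℝ 6 U) {r : ℝ} (hr : 0 < r) :
    (fun y => (euler (angularDensity p U) y + 2 * kappa p * angularDensity p U y)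
      + W 1 y * (euler (angularBilaplacian p U) y + kappa p * angularBilaplacian p U y)
      - (W 2 y + 5 * W 1 y) * angularBilaplacian p U y
      - angularDissipation p U y) ∈ sphNull (Space n) r := by
  have hW (j : ℕ) (hj : (2 + j : WithTop ℕ∞) ≤ 6) : ContDiff ℝ 2 (W j) :=
    contDiff_ladder _ j hU hj
  have hS (j : ℕ) (hj : (4 + j : WithTop ℕ∞) ≤ 6) : ContDiff ℝ 2 (sphLaplacian (W j)) :=
    contDiff_sphLaplacian (contDiff_ladder _ j hU hj) (by norm_num)
  have W0 := hW 0 (by norm_num)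
  have W1 := hW 1 (by norm_num)
  have W2 := hW 2 (by norm_num)
  have W3 := hW 3 (by norm_num)
  have S0 := hS 0 (by norm_num)
  have S1 := hS 1 (by norm_num)
  let green {f g : Space n → ℝ} (c : ℝ) (hf : ContDiff ℝ 2 f) (hg : ContDiff ℝ 2 g) :
      sphNull (Space n) r :=
    ⟨_, mul_sphLaplacian_add_sphInner_mem_sphNull hf hg hr c⟩
  have hmem := (green 2 W1 W3 + green (2 * alpha n p - 6) W1 W2
    + green (2 * (beta n p - n + 4) - 8 * alpha n p) W1 W1
    + green (-10 * (beta n p - n + 4)) W1 W0 + green (-2) W2 W2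
    + green (-2 * alpha n p) W2 W1 + green (-2 * (beta n p - n + 4)) W2 W0
    + green 1 W1 S1 + green (-1) S1 W1 + green (-5) W1 S0 + green 5 S0 W1
    + green (-1) W2 S0 + green 1 S0 W2).2
  refine (congrArg (· ∈ sphNull (Space n) r) (funext fun y => ?_)).mp hmem
  simp only [green, Submodule.coe_add, Pi.add_apply]
  linear_combination (norm := skip) -euler_angularDensity hU y
    - W 1 y * euler_angularBilaplacian hU y
  unfold angularBilaplacian angularDissipation
  simp only [sphInner_comm (W 2) (W 1), sphInner_comm (W 1) (W 0), sphInner_comm (W 2) (W 0),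
    sphInner_comm (sphLaplacian _) (W _)]
  ring

theorem norm_pow_mul_bilaplacian_eq (hU : ContDiff ℝ 6 U) (y : Space n) :
    ‖y‖ ^ 4 * (Δ (Δ U)) y = radialBilaplacian p U y + angularBilaplacian p U y := by
  rw [norm_pow_mul_bilaplacian (kappa p) hU, finrank_euclideanSpace_fin]
  simp only [radialBilaplacian, angularBilaplacian, delta1, delta2, delta3, delta4, alpha, beta]
  ring

theorem norm_pow_mul_bilaplacian_ladder_one (hU : ContDiff ℝ 6 U) (y : Space n) :
    ‖y‖ ^ 4 * (Δ (Δ (W 1))) y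
      = (euler (radialBilaplacian p U) y + kappa p * radialBilaplacian p U y)
        + (euler (angularBilaplacian p U) y + kappa p * angularBilaplacian p U y) := by
  have hΔΔ := ((hasScalingDeriv_ladder_one (kappa p) hU (by norm_num)).laplacian
    (hU.of_le (by norm_num))).laplacian (contDiff_laplacian hU (by norm_num))
  have h := hΔΔ.normSq_mul.normSq_mul.euler_add_mul y
  have hpow (f : Space n → ℝ) (z : Space n) : ‖z‖ ^ 2 * (‖z‖ ^ 2 * f z) = ‖z‖ ^ 4 * f z := by ring
  simp only [hpow, norm_pow_mul_bilaplacian_eq (p := p) hU] at h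
  rw [← h, euler_add ((contDiff_radialBilaplacian hU).differentiable one_ne_zero y)
    ((contDiff_angularBilaplacian hU).differentiable one_ne_zero y)]
  ring

theorem contDiff_radialDensity (hU : ContDiff ℝ 6 U) : ContDiff ℝ 1 (radialDensity p U) := by
  have hW (j : ℕ) (hj : (1 + j : WithTop ℕ∞) ≤ 6) : ContDiff ℝ 1 (W j) :=
    contDiff_ladder _ j hU hj
  have h0 := hW 0 (by norm_num)
  have h1 := hW 1 (by norm_num)
  have h2 := hW 2 (by norm_num)
  have h3 := hW 3 (by norm_num)
  have h4 := hW 4 (by norm_num)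
  unfold radialDensity
  fun_prop

theorem contDiff_angularDensity (hU : ContDiff ℝ 6 U) : ContDiff ℝ 1 (angularDensity p U) := by
  have hS0 : ContDiff ℝ 1 (sphLaplacian (W 0)) :=
    contDiff_sphLaplacian_ladder _ 0 hU (by norm_num)
  have hS1 : ContDiff ℝ 1 (sphLaplacian (W 1)) :=
    contDiff_sphLaplacian_ladder _ 1 hU (by norm_num)
  have hI (i j : ℕ) (hi : (2 + i : WithTop ℕ∞) ≤ 6) (hj : (2 + j : WithTop ℕ∞) ≤ 6) :
      ContDiff ℝ 1 (sphInner (W i) (W j)) :=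
    contDiff_sphInner_ladder _ i j hU hi hj
  have hI00 := hI 0 0 (by norm_num) (by norm_num)
  have hI01 := hI 0 1 (by norm_num) (by norm_num)
  have hI11 := hI 1 1 (by norm_num) (by norm_num)
  have hI12 := hI 1 2 (by norm_num) (by norm_num)
  unfold angularDensity
  fun_prop

theorem contDiff_normSq_mul_laplacian (hU : ContDiff ℝ 6 U) :
    ContDiff ℝ 1 fun y : Space n => ‖y‖ ^ 2 * (Δ U) y :=
  (contDiff_norm_sq ℝ).mul (contDiff_laplacian hU (by norm_num))

theorem contDiff_boundaryDensity (hU : ContDiff ℝ 6 U) :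
    ContDiff ℝ 1 (boundaryDensity p U) := by
  have hV := contDiff_normSq_mul_laplacian hU
  exact ((contDiff_radialDensity hU).add (contDiff_const.mul (hV.mul hV))).add
    (contDiff_angularDensity hU)

theorem euler_boundaryDensity (hU : ContDiff ℝ 6 U) (y : Space n) :
    euler (boundaryDensity p U) y + 2 * kappa p * boundaryDensity p U y
      = (euler (radialDensity p U) y + 2 * kappa p * radialDensity p U y)
        + (kappa p + 2) * ‖y‖ ^ 4 * ((Δ U) y * (Δ (W 1)) y)
        + (euler (angularDensity p U) y + 2 * kappa p * angularDensity p U y) := by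
  have hV := ((hasScalingDeriv_ladder_one (kappa p) hU (by norm_num)).laplacian
    (hU.of_le (by norm_num))).normSq_mul
  rw [add_sub_cancel_right] at hV
  have hP := ((hV.mul hV).const_mul (1 / 2 * (kappa p + 2)))
  have hR := (contDiff_radialDensity (p := p) hU).differentiable one_ne_zero y
  have hA := (contDiff_angularDensity (p := p) hU).differentiable one_ne_zero y
  have hadd : euler (boundaryDensity p U) y = _ :=
    (euler_add (hR.add (hP.differentiable y)) hA).trans
      (congrArg (· + _) (euler_add hR (hP.differentiable y)))
  rw [hadd, boundaryDensity]
  linear_combination hP.euler_add_mul y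

theorem sphIntegral_balance [Nontrivial (Space n)] (hU : ContDiff ℝ 6 U) {r : ℝ} (hr : 0 < r) :
    r ^ 4 * sphIntegral (fun y => inner ℝ y (greenField (W 1) (Δ U) y)) r
      + sphIntegral (fun y =>
        euler (boundaryDensity p U) y + 2 * kappa p * boundaryDensity p U y) r
      = sphIntegral (dissipation p U) r := by
  obtain ⟨hN, hN0⟩ := angular_balance (p := p) hU hr
  have hW1 : ContDiff ℝ 5 (W 1) := contDiff_ladder _ 1 hU (by norm_num)
  have hgreen : Continuous fun y => r ^ 4 * inner ℝ y (greenField (W 1) (Δ U) y) :=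
    continuous_const.mul (continuous_id.inner (contDiff_greenField
      (hW1.of_le (by norm_num)) (contDiff_laplacian hU (by norm_num))).continuous)
  have hQ := contDiff_boundaryDensity (p := p) hU
  have hQ' : Continuous fun y =>
      euler (boundaryDensity p U) y + 2 * kappa p * boundaryDensity p U y :=
    (continuous_euler hQ).add (continuous_const.mul hQ.continuous)
  rw [← sphIntegral_const_mul, ← sphIntegral_add hgreen hQ', ← sub_zero (sphIntegral _ r), ← hN0]
  refine (sphIntegral_sub (hgreen.add hQ') hN r).symm.trans
    (sphIntegral_congr hr.le fun y hy => ?_)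
  rw [Pi.add_apply, inner_self_greenField_ladder (kappa p) (hU.of_le (by norm_num)),
    euler_boundaryDensity hU, dissipation, ← hy]
  linear_combination radial_balance (p := p) hU y
    + W 1 y * norm_pow_mul_bilaplacian_ladder_one (p := p) hU y
    - (W 2 y + 5 * W 1 y) * norm_pow_mul_bilaplacian_eq (p := p) hU y

end Balance

/-! ### Translation to the origin -/

section Translation

variable {n : ℕ} (x : Space n)

theorem gradient_shift (f : Space n → ℝ) (y : Space n) :
    ∇ f (x + y) = ∇ (fun z => f (x + z)) y := by
  rw [gradient, gradient, fderiv_comp_add_left]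

theorem laplacian_shift (f : Space n → ℝ) :
    Δ (fun z => f (x + z)) = fun y => (Δ f) (x + y) := by
  funext y
  simp only [InnerProductSpace.laplacian_eq_iteratedFDeriv_stdOrthonormalBasis,
    iteratedFDeriv_comp_add_left]

theorem setIntegral_ball_shift (r : ℝ) (f : Space n → ℝ) :
    ∫ y in Metric.ball x r, f y = ∫ y in Metric.ball 0 r, f (x + y) := by
  have h := (measurePreserving_add_left (volume : Measure (Space n)) x).setIntegral_preimage_emb
    (measurableEmbedding_addLeft x) f (Metric.ball x r)
  rw [← h]
  congr 2
  ext y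
  simp

theorem IsSolution.shift {p : ℝ} {u : Space n → ℝ} (hu : IsSolution p u) :
    ContDiff ℝ 6 (fun y => u (x + y)) ∧ ∀ y, -(Δ (Δ (Δ fun z => u (x + z)))) y
      = |u (x + y)| ^ (p - 1) * u (x + y) := by
  refine ⟨hu.contDiff.comp (contDiff_const.add contDiff_id), fun y => ?_⟩
  have hneg (f : Space n → ℝ) : negLaplacian f = -(Δ f) := rfl
  rw [← hu.equation (x + y), laplacian_shift, laplacian_shift x (Δ u),
    laplacian_shift x (Δ (Δ u))]
  simp only [Function.iterate_succ, Function.iterate_zero, Function.comp_apply, id, hneg,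
    InnerProductSpace.laplacian_neg, neg_neg, Pi.neg_apply]

theorem radialDeriv_shift (f : Space n → ℝ) (y : Space n) :
    radialDeriv x f (x + y) = ‖y‖⁻¹ * euler (fun z => f (x + z)) y := by
  rw [radialDeriv, add_sub_cancel_left, real_inner_smul_right, inner_gradient_left, euler,
    fderiv_comp_add_left]

theorem normSq_mul_tangentialSq (f : Space n → ℝ) {y : Space n} (hy : y ≠ 0) :
    ‖y‖ ^ 2 * tangentialSq x f (x + y)
      = sphInner (fun z => f (x + z)) (fun z => f (x + z)) y := by
  have hn : ‖y‖ ≠ 0 := norm_ne_zero_iff.2 hy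
  rw [tangentialSq, gradient_shift, radialDeriv_shift, sphInner_eq, real_inner_self_eq_norm_sq]
  field_simp

end Translation

/-! ### Radial derivatives -/

section InvNorm

variable {E : Type*} [NormedAddCommGroup E] [InnerProductSpace ℝ E] {y : E}

theorem hasFDerivAt_inv_norm (hy : y ≠ 0) :
    HasFDerivAt (fun z : E => ‖z‖⁻¹) (-(‖y‖⁻¹ ^ 3) • innerSL ℝ y) y := by
  have hn : ‖y‖ ≠ 0 := norm_ne_zero_iff.2 hy
  have h1 : HasFDerivAt (fun z : E => ‖z‖) (‖y‖⁻¹ • innerSL ℝ y) y := by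
    refine (((hasStrictFDerivAt_norm_sq y).hasFDerivAt.sqrt (by positivity)).congr_of_eventuallyEq
      (.of_forall fun z => (Real.sqrt_sq (norm_nonneg z)).symm)).congr_fderiv ?_
    ext v
    simp only [norm_nonneg, Real.sqrt_sq, one_div, mul_inv_rev, smul_apply, coe_innerSL_apply,
      nsmul_eq_mul, Nat.cast_ofNat, smul_eq_mul]
    field_simp
  refine ((hasDerivAt_inv hn).comp_hasFDerivAt y h1).congr_fderiv ?_
  ext v
  simp only [neg_smul, neg_apply, smul_apply, coe_innerSL_apply, smul_eq_mul, inv_pow]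
  field_simp

theorem euler_inv_norm_pow (hy : y ≠ 0) (j : ℕ) :
    euler (fun z : E => ‖z‖⁻¹ ^ j) y = -j * ‖y‖⁻¹ ^ j := by
  have hn : ‖y‖ ≠ 0 := norm_ne_zero_iff.2 hy
  rw [euler, ((hasFDerivAt_inv_norm hy).pow j).fderiv]
  cases j with
  | zero => simp
  | succ j =>
    simp only [add_tsub_cancel_right, inv_pow, nsmul_eq_mul, Nat.cast_add, Nat.cast_one, pow_succ,
      neg_smul, smul_neg, neg_apply, smul_apply, coe_innerSL_apply, inner_self_eq_norm_sq_to_K,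
      Real.ringHom_apply, smul_eq_mul]
    field_simp

theorem sphGrad_inv_norm [FiniteDimensional ℝ E] (hy : y ≠ 0) :
    sphGrad (fun z : E => ‖z‖⁻¹) y = 0 := by
  have hn : ‖y‖ ≠ 0 := norm_ne_zero_iff.2 hy
  have hg : ∇ (fun z : E => ‖z‖⁻¹) y = -(‖y‖⁻¹ ^ 3) • y := by
    refine ext_inner_right ℝ fun v => ?_
    rw [inner_gradient_left, (hasFDerivAt_inv_norm hy).fderiv, real_inner_smul_left]
    rfl
  have he := euler_inv_norm_pow hy 1
  simp only [pow_one] at he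
  rw [sphGrad, hg, he, smul_smul, ← sub_smul]
  convert zero_smul ℝ y using 2
  field_simp
  norm_num

end InvNorm

section LadderZero

variable {E : Type*} [NormedAddCommGroup E] [NormedSpace ℝ E] {f : E → ℝ} (c : ℝ)

theorem ladder_one (f : E → ℝ) (y : E) : ladder c f 1 y = ladder 0 f 1 y + c * f y := by
  simp [ladder]

theorem ladder_two (hf : ContDiff ℝ 2 f) (y : E) :
    ladder c f 2 y = ladder 0 f 2 y + 2 * c * ladder 0 f 1 y + c * (c - 1) * f y := by
  have h0 := hasScalingDeriv_ladder_weight 0 0 hf (by norm_num)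
  have h1 := hasScalingDeriv_ladder_weight 0 1 hf (by norm_num)
  have h := (h1.add (h0.const_mul c)).euler_add_mul y
  have hs : ladder c f 2 y = euler (ladder c f 1) y + (c - (1 : ℕ)) * ladder c f 1 y := rfl
  rw [hs, funext (ladder_one c f)]
  simp only [ladder_zero] at h
  push_cast at h ⊢
  linear_combination h

theorem ladder_three (hf : ContDiff ℝ 3 f) (y : E) :
    ladder c f 3 y = ladder 0 f 3 y + 3 * c * ladder 0 f 2 y + 3 * c * (c - 1) * ladder 0 f 1 y
      + c * (c - 1) * (c - 2) * f y := by
  have h0 := hasScalingDeriv_ladder_weight 0 0 hf (by norm_num)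
  have h1 := hasScalingDeriv_ladder_weight 0 1 hf (by norm_num)
  have h2 := hasScalingDeriv_ladder_weight 0 2 hf (by norm_num)
  have h := ((h2.add (h1.const_mul (2 * c))).add (h0.const_mul (c * (c - 1)))).euler_add_mul y
  have hs : ladder c f 3 y = euler (ladder c f 2) y + (c - (2 : ℕ)) * ladder c f 2 y := rfl
  rw [hs, funext (ladder_two c (hf.of_le (by norm_num)))]
  simp only [ladder_zero] at h
  push_cast at h ⊢
  linear_combination h

theorem ladder_four (hf : ContDiff ℝ 4 f) (y : E) :
    ladder c f 4 y = ladder 0 f 4 y + 4 * c * ladder 0 f 3 y + 6 * c * (c - 1) * ladder 0 f 2 y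
      + 4 * c * (c - 1) * (c - 2) * ladder 0 f 1 y + c * (c - 1) * (c - 2) * (c - 3) * f y := by
  have h0 := hasScalingDeriv_ladder_weight 0 0 hf (by norm_num)
  have h1 := hasScalingDeriv_ladder_weight 0 1 hf (by norm_num)
  have h2 := hasScalingDeriv_ladder_weight 0 2 hf (by norm_num)
  have h3 := hasScalingDeriv_ladder_weight 0 3 hf (by norm_num)
  have h := (((h3.add (h2.const_mul (3 * c))).add (h1.const_mul (3 * c * (c - 1)))).add
    (h0.const_mul (c * (c - 1) * (c - 2)))).euler_add_mul y
  have hs : ladder c f 4 y = euler (ladder c f 3) y + (c - (3 : ℕ)) * ladder c f 3 y := rfl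
  rw [hs, funext (ladder_three c (hf.of_le (by norm_num)))]
  simp only [ladder_zero] at h
  push_cast at h ⊢
  linear_combination h

end LadderZero

theorem iterate_radialDeriv {n : ℕ} (x : Space n) (u : Space n → ℝ) (j : ℕ)
    (hU : ContDiff ℝ j fun y => u (x + y)) {y : Space n} (hy : y ≠ 0) :
    ((radialDeriv x)^[j] u) (x + y) = ‖y‖⁻¹ ^ j * ladder 0 (fun y => u (x + y)) j y := by
  induction j generalizing y with
  | zero => simp [ladder_zero]
  | succ j ih =>
    have hl : ContDiff ℝ 1 (ladder 0 (fun y => u (x + y)) j) :=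
      contDiff_ladder 0 j hU (by push_cast; rw [add_comm])
    have hev : (fun z => ((radialDeriv x)^[j] u) (x + z))
        =ᶠ[𝓝 y] fun z => ‖z‖⁻¹ ^ j • ladder 0 (fun y => u (x + y)) j z := by
      filter_upwards [isOpen_ne.mem_nhds hy] with z hz
      exact ih (hU.of_le (by exact_mod_cast Nat.le_succ j)) hz
    rw [Function.iterate_succ_apply', radialDeriv_shift, euler, hev.fderiv_eq, ← euler,
      euler_smul ((hasFDerivAt_inv_norm hy).pow j).differentiableAt
        (hl.differentiable one_ne_zero y), euler_inv_norm_pow hy, ladder]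
    simp only [smul_eq_mul]
    ring

/-! ### The energy in terms of scaling derivatives -/

section Energy

variable {n : ℕ} {p : ℝ} {x : Space n} {u : Space n → ℝ}

local notation "U" => fun y => u (x + y)

local notation "W" => ladder (kappa p) U

theorem norm_mul_radialDeriv {y : Space n} (hy : y ≠ 0) :
    ‖y‖ * radialDeriv x u (x + y) = ladder 0 U 1 y := by
  have hn : ‖y‖ ≠ 0 := norm_ne_zero_iff.2 hy
  rw [radialDeriv_shift, mul_inv_cancel_left₀ hn]
  simp [ladder]

theorem norm_pow_mul_iterate_radialDeriv (j : ℕ) (hU : ContDiff ℝ j U) {y : Space n}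
    (hy : y ≠ 0) : ‖y‖ ^ j * ((radialDeriv x)^[j] u) (x + y) = ladder 0 U j y := by
  have hn : ‖y‖ ≠ 0 := norm_ne_zero_iff.2 hy
  rw [iterate_radialDeriv x u j hU hy, ← mul_assoc, ← mul_pow, mul_inv_cancel₀ hn, one_pow, one_mul]

theorem T1_eq {y : Space n} (hy : y ≠ 0) : T1 p x u ‖y‖ (x + y) = W 1 y := by
  rw [T1, ladder_one, norm_mul_radialDeriv hy, add_comm]

theorem T2_eq (hU : ContDiff ℝ 2 U) {y : Space n} (hy : y ≠ 0) :
    T2 p x u ‖y‖ (x + y) = W 2 y := by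
  rw [T2, ladder_two _ hU]
  linear_combination 2 * kappa p * norm_mul_radialDeriv (u := u) (x := x) hy
    + norm_pow_mul_iterate_radialDeriv 2 hU hy

theorem T3_eq (hU : ContDiff ℝ 3 U) {y : Space n} (hy : y ≠ 0) :
    T3 p x u ‖y‖ (x + y) = W 3 y := by
  rw [T3, ladder_three _ hU]
  linear_combination 3 * kappa p * (kappa p - 1) * norm_mul_radialDeriv (u := u) (x := x) hy
    + 3 * kappa p * norm_pow_mul_iterate_radialDeriv 2 (hU.of_le (by norm_num)) hy
    + norm_pow_mul_iterate_radialDeriv 3 hU hy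

theorem T4_eq (hU : ContDiff ℝ 4 U) {y : Space n} (hy : y ≠ 0) :
    T4 p x u ‖y‖ (x + y) = W 4 y := by
  rw [T4, ladder_four _ hU]
  linear_combination
    4 * kappa p * (kappa p - 1) * (kappa p - 2) * norm_mul_radialDeriv (u := u) (x := x) hy
    + 6 * kappa p * (kappa p - 1) *
      norm_pow_mul_iterate_radialDeriv 2 (hU.of_le (by norm_num)) hy
    + 4 * kappa p * norm_pow_mul_iterate_radialDeriv 3 (hU.of_le (by norm_num)) hy
    + norm_pow_mul_iterate_radialDeriv 4 hU hy

theorem angularPart_eq (hU : ContDiff ℝ 3 U) {y : Space n} (hy : y ≠ 0) :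
    angularPart x u ‖y‖ (x + y) = sphLaplacian U y := by
  have h := normSq_mul_laplacian_ladder 0 hU y
  rw [laplacian_shift, ladder_zero, finrank_euclideanSpace_fin] at h
  rw [angularPart]
  linear_combination h - norm_pow_mul_iterate_radialDeriv 2 (hU.of_le (by norm_num)) hy
    - ((n : ℝ) - 1) * norm_mul_radialDeriv (u := u) (x := x) hy

theorem normSq_mul_tangentialSq_T1 (hU : ContDiff ℝ 2 U) {y : Space n} (hy : y ≠ 0) :
    ‖y‖ ^ 2 * tangentialSq x (T1 p x u ‖y‖) (x + y) = sphInner (W 1) (W 1) y := by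
  have hn : ‖y‖ ≠ 0 := norm_ne_zero_iff.2 hy
  have hU0 : DifferentiableAt ℝ U y := hU.differentiable two_ne_zero y
  have hE : DifferentiableAt ℝ (euler U) y :=
    (contDiff_euler hU (m := 1) (by norm_num)).differentiable one_ne_zero y
  have hinv : DifferentiableAt ℝ (fun z : Space n => ‖z‖⁻¹) y :=
    (hasFDerivAt_inv_norm hy).differentiableAt
  have hT : (fun z => T1 p x u ‖y‖ (x + z))
      = fun z => kappa p * u (x + z) + ‖y‖ * (‖z‖⁻¹ * euler U z) := by
    funext z
    rw [T1, radialDeriv_shift]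
  have hW : W 1 = fun z => kappa p * u (x + z) + euler U z := by
    funext z
    simp [ladder, add_comm]
  have h : sphGrad (fun z => T1 p x u ‖y‖ (x + z)) y = sphGrad (W 1) y := by
    rw [hT, hW, sphGrad_add (hU0.const_mul _) ((hinv.fun_mul hE).const_mul _),
      sphGrad_add (hU0.const_mul _) hE, sphGrad_const_mul (hinv.fun_mul hE), sphGrad_mul hinv hE,
      sphGrad_inv_norm hy, smul_zero, add_zero, smul_smul, mul_inv_cancel₀ hn, one_smul]
  rw [normSq_mul_tangentialSq x _ hy]
  refine mul_left_cancel₀ (pow_ne_zero 2 hn) ?_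
  rw [← norm_sphGrad_sq, ← norm_sphGrad_sq, h]

theorem hasDerivAt_rpow_smul_ray {F : Type*} [NormedAddCommGroup F] [NormedSpace ℝ F]
    {f : Space n → F} (hf : Differentiable ℝ f) (c : ℝ) (θ : Space n) {t : ℝ} (ht : 0 < t) :
    HasDerivAt (fun s : ℝ => s ^ c • f (s • θ))
      (t ^ (c - 1) • (euler f (t • θ) + c • f (t • θ))) t := by
  refine ((Real.hasDerivAt_rpow_const (p := c) (Or.inl ht.ne')).fun_smul
    (hasDerivAt_ray hf ht.ne' θ)).congr_deriv ?_
  rw [smul_smul, Real.rpow_sub_one ht.ne', smul_add, smul_smul, mul_comm c, div_eq_mul_inv]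

theorem rayDeriv_eq {Q : ℝ → Space n → ℝ} {c : ℝ} {q q' : Space n → ℝ}
    (hq : HasScalingDeriv c q q')
    (h : ∀ z ≠ 0, ‖z‖ ^ (2 * kappa p) * Q ‖z‖ (x + z) = ‖z‖ ^ c * q z) {y : Space n}
    (hy : y ≠ 0) : rayDeriv p x Q ‖y‖ (x + y) = ‖y‖ ^ (c - 1) * q' y := by
  have hn : 0 < ‖y‖ := norm_pos_iff.2 hy
  have hray : (fun s : ℝ => s ^ (2 * kappa p) * Q s (x + (s / ‖y‖) • (x + y - x)))
      =ᶠ[𝓝 ‖y‖] fun s => s ^ c • q (s • ‖y‖⁻¹ • y) := by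
    filter_upwards [lt_mem_nhds hn] with s hs
    have hs' : ‖s • ‖y‖⁻¹ • y‖ = s := by
      rw [norm_smul, norm_smul, norm_inv, norm_norm, inv_mul_cancel₀ hn.ne', mul_one,
        Real.norm_of_nonneg hs.le]
    have h0 := h (s • ‖y‖⁻¹ • y) (norm_pos_iff.1 (by rwa [hs']))
    rw [hs', smul_smul, ← div_eq_mul_inv] at h0
    rw [add_sub_cancel_left, h0, smul_smul, ← div_eq_mul_inv, smul_eq_mul]
  rw [rayDeriv, hray.deriv_eq, (hasDerivAt_rpow_smul_ray hq.differentiable c _ hn).deriv,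
    smul_inv_smul₀ hn.ne', smul_eq_mul, smul_eq_mul, hq.euler_add_mul]

theorem sphereIntegral_eq_sphIntegral (hn : 1 ≤ n) {a t : ℝ} (ht : 0 < t) {f q : Space n → ℝ}
    (h : ∀ y, ‖y‖ = t → f (x + y) = t ^ (a + 1 - n) * q y) :
    sphereIntegral x t f = t ^ a * sphIntegral q t := by
  have hs : sphereIntegral x t f = t ^ (n - 1) * sphIntegral (fun y => f (x + y)) t := rfl
  rw [hs, sphIntegral_congr ht.le h, sphIntegral_const_mul, ← mul_assoc,
    ← Real.rpow_natCast t (n - 1), ← Real.rpow_add ht, Nat.cast_sub hn]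
  congr 2
  push_cast
  ring

theorem sphereIntegral_rpow_mul (hn : 1 ≤ n) {t : ℝ} (ht : 0 < t) {f : ℝ → Space n → ℝ}
    {q : Space n → ℝ} (h : ∀ y ≠ 0, f ‖y‖ (x + y) = q y) (a : ℝ) :
    sphereIntegral x t (fun y => t ^ (a + 1 - n) * f t y) = t ^ a * sphIntegral q t := by
  refine sphereIntegral_eq_sphIntegral hn ht fun y hy => ?_
  subst hy
  rw [h y (norm_pos_iff.1 ht)]

theorem sphereIntegral_rpow_mul_mul (hn : 1 ≤ n) {t : ℝ} (ht : 0 < t) {f g : ℝ → Space n → ℝ}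
    {q r : Space n → ℝ} (hf : ∀ y ≠ 0, f ‖y‖ (x + y) = q y)
    (hg : ∀ y ≠ 0, g ‖y‖ (x + y) = r y) (a : ℝ) :
    sphereIntegral x t (fun y => t ^ (a + 1 - n) * (f t y * g t y))
      = t ^ a * sphIntegral (fun y => q y * r y) t :=
  sphereIntegral_rpow_mul hn ht (f := fun s z => f s z * g s z)
    (fun y hy => congrArg₂ (· * ·) (hf y hy) (hg y hy)) a

theorem sphereIntegral_rpow_mul_sq (hn : 1 ≤ n) {t : ℝ} (ht : 0 < t) {f : ℝ → Space n → ℝ}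
    {q : Space n → ℝ} (h : ∀ y ≠ 0, f ‖y‖ (x + y) = q y) (a : ℝ) :
    sphereIntegral x t (fun y => t ^ (a + 1 - n) * f t y ^ 2)
      = t ^ a * sphIntegral (fun y => q y * q y) t :=
  sphereIntegral_rpow_mul hn ht (f := fun s z => f s z ^ 2)
    (fun y hy => by rw [h y hy, sq]) a

theorem sphereIntegral_rpow_mul_rayDeriv (hn : 1 ≤ n) {t : ℝ} (ht : 0 < t)
    {Q : ℝ → Space n → ℝ} {a b c : ℝ} {q q' : Space n → ℝ} (hq : HasScalingDeriv c q q')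
    (h : ∀ z ≠ 0, ‖z‖ ^ (2 * kappa p) * Q ‖z‖ (x + z) = ‖z‖ ^ c * q z) (hb : b + c = a + 2 - n) :
    sphereIntegral x t (fun y => t ^ b * rayDeriv p x Q t y) = t ^ a * sphIntegral q' t := by
  refine sphereIntegral_eq_sphIntegral hn ht fun y hy => ?_
  subst hy
  rw [rayDeriv_eq hq h (norm_pos_iff.1 ht), ← mul_assoc, ← Real.rpow_add ht,
    show b + (c - 1) = a + 1 - n by linear_combination hb]

theorem sphIntegral_radialDensity (hU : ContDiff ℝ 6 U) (t : ℝ) :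
    sphIntegral (radialDensity p U) t
      = -sphIntegral (fun y => W 4 y * W 1 y) t + 2 * sphIntegral (fun y => W 3 y * W 2 y) t
        - (delta1 n p - 6) * sphIntegral (fun y => W 3 y * W 1 y) t
        - (24 - 6 * delta1 n p + delta2 n p) * sphIntegral (fun y => W 2 y * W 1 y) t
        - (9 * delta1 n p - 3 * delta2 n p - 36) * sphIntegral (fun y => W 1 y * W 1 y) t
        + (delta1 n p - 8) * sphIntegral (fun y => W 2 y * W 2 y) t
        + delta4 n p * sphIntegral (fun y => W 1 y * W 0 y) t
        + 2 * delta4 n p * sphIntegral (fun y => W 0 y * W 0 y) t := by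
  have hW (j : ℕ) (hj : (0 + j : WithTop ℕ∞) ≤ 6) : Continuous (W j) :=
    (contDiff_ladder _ j hU hj).continuous
  have c0 := hW 0 (by norm_num)
  have c1 := hW 1 (by norm_num)
  have c2 := hW 2 (by norm_num)
  have c3 := hW 3 (by norm_num)
  have c4 := hW 4 (by norm_num)
  unfold radialDensity
  iterate 7 rw [sphIntegral_add (by fun_prop) (by fun_prop)]
  simp only [sphIntegral_const_mul]
  ring

theorem sphIntegral_angularDensity (hU : ContDiff ℝ 6 U) (t : ℝ) :
    sphIntegral (angularDensity p U) t
      = 2 * sphIntegral (fun y => sphLaplacian (W 0) y * sphLaplacian (W 0) y) t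
        + sphIntegral (fun y => sphLaplacian (W 0) y * sphLaplacian (W 1) y) t
        - 4 * (beta n p - n + 4) * sphIntegral (sphInner (W 0) (W 0)) t
        - 2 * (beta n p - n + 4) * sphIntegral (sphInner (W 0) (W 1)) t
        - 6 * sphIntegral (sphInner (W 1) (W 1)) t
        + 2 * sphIntegral (sphInner (W 1) (W 2)) t := by
  have hS (j : ℕ) (hj : (0 + 2 + j : WithTop ℕ∞) ≤ 6) : Continuous (sphLaplacian (W j)) :=
    (contDiff_sphLaplacian_ladder _ j hU hj).continuous
  have hI (i j : ℕ) (hi : (0 + 1 + i : WithTop ℕ∞) ≤ 6) (hj : (0 + 1 + j : WithTop ℕ∞) ≤ 6) :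
      Continuous (sphInner (W i) (W j)) :=
    (contDiff_sphInner_ladder _ i j hU hi hj).continuous
  have hS0 := hS 0 (by norm_num)
  have hS1 := hS 1 (by norm_num)
  have hI00 := hI 0 0 (by norm_num) (by norm_num)
  have hI01 := hI 0 1 (by norm_num) (by norm_num)
  have hI11 := hI 1 1 (by norm_num) (by norm_num)
  have hI12 := hI 1 2 (by norm_num) (by norm_num)
  unfold angularDensity
  iterate 5 rw [sphIntegral_add (by fun_prop) (by fun_prop)]
  simp only [sphIntegral_const_mul]
  ring

theorem radial_energy_eq (hn : 1 ≤ n) (hU : ContDiff ℝ 6 U) {t : ℝ} (ht : 0 < t) :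
    -sphereIntegral x t (fun y => t ^ (2 * kappa p + 1 - n) * (T4 p x u t y * T1 p x u t y))
      + 2 * sphereIntegral x t
        (fun y => t ^ (2 * kappa p + 1 - n) * (T3 p x u t y * T2 p x u t y))
      - (delta1 n p - 6) * sphereIntegral x t
        (fun y => t ^ (2 * kappa p + 1 - n) * (T3 p x u t y * T1 p x u t y))
      - (24 - 6 * delta1 n p + delta2 n p) * sphereIntegral x t
        (fun y => t ^ (2 * kappa p + 1 - n) * (T2 p x u t y * T1 p x u t y))
      - (9 * delta1 n p - 3 * delta2 n p - 36) * sphereIntegral x t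
        (fun y => t ^ (2 * kappa p + 1 - n) * T1 p x u t y ^ 2)
      + (delta1 n p - 8) * sphereIntegral x t
        (fun y => t ^ (2 * kappa p + 1 - n) * T2 p x u t y ^ 2)
      + delta4 n p * sphereIntegral x t
        (fun y => t ^ (2 * kappa p + 1 - n) * (T1 p x u t y * u y))
      + 2 * delta4 n p * sphereIntegral x t (fun y => t ^ (2 * kappa p + 1 - n) * u y ^ 2)
      = t ^ (2 * kappa p) * sphIntegral (radialDensity p U) t := by
  have h0 (y : Space n) (_ : y ≠ 0) : (fun _ : ℝ => u) ‖y‖ (x + y) = W 0 y := rfl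
  have h1 (y : Space n) (hy : y ≠ 0) := T1_eq (p := p) (u := u) (x := x) hy
  have h2 (y : Space n) (hy : y ≠ 0) := T2_eq (p := p) (hU.of_le (by norm_num)) hy
  have h3 (y : Space n) (hy : y ≠ 0) := T3_eq (p := p) (hU.of_le (by norm_num)) hy
  have h4 (y : Space n) (hy : y ≠ 0) := T4_eq (p := p) (hU.of_le (by norm_num)) hy
  rw [sphereIntegral_rpow_mul_mul hn ht h4 h1, sphereIntegral_rpow_mul_mul hn ht h3 h2,
    sphereIntegral_rpow_mul_mul hn ht h3 h1, sphereIntegral_rpow_mul_mul hn ht h2 h1,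
    sphereIntegral_rpow_mul_sq hn ht h1, sphereIntegral_rpow_mul_sq hn ht h2,
    sphereIntegral_rpow_mul_mul hn ht (g := fun _ => u) h1 h0,
    sphereIntegral_rpow_mul_sq hn ht (f := fun _ => u) h0]
  rw [sphIntegral_radialDensity hU]
  ring

theorem laplacian_energy_eq (hn : 1 ≤ n) {t : ℝ} (ht : 0 < t) :
    t ^ (2 * kappa p + 6 - n - 1) * sphereIntegral x t (fun y => (Δ u) y ^ 2)
      = t ^ (2 * kappa p)
        * sphIntegral (fun y => ‖y‖ ^ 2 * (Δ U) y * (‖y‖ ^ 2 * (Δ U) y)) t := by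
  have h := sphereIntegral_eq_sphIntegral (a := n - 1) (q := fun y => (Δ U) y ^ 2) (x := x)
    (f := fun y => (Δ u) y ^ 2) hn ht (fun y _ => by simp [laplacian_shift])
  have hV : sphIntegral (fun y => ‖y‖ ^ 2 * (Δ U) y * (‖y‖ ^ 2 * (Δ U) y)) t
      = t ^ 4 * sphIntegral (fun y => (Δ U) y ^ 2) t := by
    rw [← sphIntegral_const_mul]
    refine sphIntegral_congr ht.le fun y hy => ?_
    rw [hy]
    ring
  rw [h, hV, ← mul_assoc, ← mul_assoc, ← Real.rpow_add ht, ← Real.rpow_add_natCast ht.ne']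
  congr 2
  push_cast
  ring

theorem angular_energy_eq (hn : 1 ≤ n) (hU : ContDiff ℝ 6 U) {t : ℝ} (ht : 0 < t) :
    2 * sphereIntegral x t (fun y =>
        t ^ (2 * kappa p + 1 - n) * angularPart x u t y ^ 2)
      + 1 / 2 * sphereIntegral x t (fun y =>
        t ^ (2 - (n : ℝ)) * rayDeriv p x (fun t z => angularPart x u t z ^ 2) t y)
      - 4 * (beta n p - n + 4) * sphereIntegral x t (fun y =>
        t ^ (2 * kappa p + 1 - n) * (t ^ 2 * tangentialSq x u y))
      - (beta n p - n + 4) * sphereIntegral x t (fun y =>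
        t ^ (2 - (n : ℝ)) * rayDeriv p x (fun t z => t ^ 2 * tangentialSq x u z) t y)
      - 6 * sphereIntegral x t (fun y =>
        t ^ (2 * kappa p + 1 - n) * (t ^ 2 * tangentialSq x (T1 p x u t) y))
      + sphereIntegral x t (fun y =>
        t ^ (4 - (n : ℝ)) * rayDeriv p x (fun t z => tangentialSq x (T1 p x u t) z) t y)
      = t ^ (2 * kappa p) * sphIntegral (angularDensity p U) t := by
  have hU3 : ContDiff ℝ 3 U := hU.of_le (by norm_num)
  have hS (y : Space n) (hy : y ≠ 0) := angularPart_eq hU3 hy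
  have hI0 (y : Space n) (hy : y ≠ 0) := normSq_mul_tangentialSq x u hy
  have hI1 (y : Space n) (hy : y ≠ 0) :=
    normSq_mul_tangentialSq_T1 (p := p) (hU.of_le (by norm_num)) hy
  rw [sphereIntegral_rpow_mul_sq hn ht hS,
    sphereIntegral_rpow_mul hn ht (f := fun s z => s ^ 2 * tangentialSq x u z) hI0,
    sphereIntegral_rpow_mul hn ht (f := fun s z => s ^ 2 * tangentialSq x (T1 p x u s) z) hI1,
    sphereIntegral_rpow_mul_rayDeriv (a := 2 * kappa p) hn ht
      (hasScalingDeriv_sphLaplacian_sq (kappa p) hU3)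
      (fun z hz => by rw [hS z hz, sq]) (by ring),
    sphereIntegral_rpow_mul_rayDeriv (a := 2 * kappa p) hn ht
      (hasScalingDeriv_sphInner_self (kappa p) 0 hU3 (by norm_num))
      (fun z hz => by rw [hI0 z hz, Nat.cast_zero, sub_zero, ladder_zero]) (by push_cast; ring),
    sphereIntegral_rpow_mul_rayDeriv (a := 2 * kappa p) hn ht
      (hasScalingDeriv_sphInner_self (kappa p) 1 hU3 (by norm_num))
      (fun z hz => by
        rw [← hI1 z hz, ← mul_assoc, ← Real.rpow_add_natCast (norm_ne_zero_iff.2 hz)]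
        congr 2
        push_cast
        ring) (by push_cast; ring)]
  rw [sphIntegral_angularDensity hU]
  simp only [sphIntegral_const_mul, ladder_zero, zero_add, Nat.reduceAdd]
  ring

theorem energy_exponent (hp : 1 < p) : 6 * ((p + 1) / (p - 1)) - n = 2 * kappa p + 6 - n := by
  have : p - 1 ≠ 0 := by linarith
  rw [kappa]
  field_simp
  ring

theorem bulk_energy_eq (hp : 1 < p) (hU : ContDiff ℝ 6 U) (t : ℝ) :
    (∫ y in Metric.ball x t, 1 / 2 * ‖∇ (Δ u) y‖ ^ 2)
      - 1 / (p + 1) * ∫ y in Metric.ball x t, |u y| ^ (p + 1)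
    = ∫ y in Metric.ball 0 t, bulkDensity p U y := by
  have hint {g : Space n → ℝ} (hg : Continuous g) : IntegrableOn g (Metric.ball 0 t) :=
    (hg.continuousOn.integrableOn_compact (isCompact_closedBall 0 t)).mono_set
      Metric.ball_subset_closedBall
  have hG : Continuous (∇ (Δ U)) :=
    (contDiff_gradient (contDiff_laplacian hU (m := 1) (by norm_num)) (m := 0)
      (by norm_num)).continuous
  have hP : Continuous fun y => |u (x + y)| ^ (p + 1) :=
    hU.continuous.abs.rpow_const fun y => Or.inr (by linarith)
  rw [setIntegral_ball_shift, setIntegral_ball_shift x t (fun y => |u y| ^ (p + 1)),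
    ← integral_const_mul]
  simp_rw [gradient_shift, ← laplacian_shift]
  exact (integral_sub (hint (by fun_prop)) (hint (by fun_prop))).symm

theorem energy_eq (hn : 1 ≤ n) (hp : 1 < p) (hU : ContDiff ℝ 6 U) {t : ℝ}
    (ht : 0 < t) :
    energy p t x u
      = t ^ (2 * kappa p + 6 - n) * (∫ y in Metric.ball 0 t, bulkDensity p U y)
        + t ^ (2 * kappa p) * sphIntegral (boundaryDensity p U) t := by
  have hR := (contDiff_radialDensity (p := p) hU).continuous
  have hA := (contDiff_angularDensity (p := p) hU).continuous
  have hV := (contDiff_normSq_mul_laplacian hU).continuous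
  have hB : sphIntegral (boundaryDensity p U) t = sphIntegral (radialDensity p U) t
      + 1 / 2 * (kappa p + 2)
        * sphIntegral (fun y => ‖y‖ ^ 2 * (Δ U) y * (‖y‖ ^ 2 * (Δ U) y)) t
      + sphIntegral (angularDensity p U) t := by
    unfold boundaryDensity
    rw [sphIntegral_add (by fun_prop) hA, sphIntegral_add hR (by fun_prop), sphIntegral_const_mul]
  rw [energy, energy_exponent hp, bulk_energy_eq hp hU, hB,
    show 2 * kappa p + 6 - n - 5 = 2 * kappa p + 1 - n by ring]
  linear_combination radial_energy_eq (p := p) hn hU ht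
    + 1 / 2 * (kappa p + 2) * laplacian_energy_eq (u := u) (x := x) hn ht
    + angular_energy_eq (p := p) hn hU ht

end Energy

/-! ### Derivatives of the rescaled function -/

section Normalize

variable {E : Type*} [NormedAddCommGroup E] [InnerProductSpace ℝ E] {θ : E} {t : ℝ}

theorem hasFDerivAt_normalize (hθ : ‖θ‖ = 1) :
    HasFDerivAt (fun y : E => ‖y‖⁻¹ • y)
      (ContinuousLinearMap.id ℝ E - (innerSL ℝ θ).smulRight θ) θ := by
  have h0 : θ ≠ 0 := norm_pos_iff.1 (by rw [hθ]; exact one_pos)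
  refine ((hasFDerivAt_inv_norm h0).fun_smul (hasFDerivAt_id θ)).congr_fderiv ?_
  ext v
  simp [hθ, sub_eq_add_neg]

theorem fderiv_comp_smul_normalize {F : Type*} [NormedAddCommGroup F] [NormedSpace ℝ F]
    {f : E → F} (hf : Differentiable ℝ f) (hθ : ‖θ‖ = 1) (t : ℝ) :
    fderiv ℝ (fun y => f (t • ‖y‖⁻¹ • y)) θ
      = t • (fderiv ℝ f (t • θ) - (innerSL ℝ θ).smulRight (fderiv ℝ f (t • θ) θ)) := by
  have h := (hf (t • ‖θ‖⁻¹ • θ)).hasFDerivAt.comp θ ((hasFDerivAt_normalize hθ).const_smul t)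
  rw [hθ, inv_one, one_smul] at h
  refine h.fderiv.trans ?_
  ext v
  simp

variable [FiniteDimensional ℝ E]

theorem gradient_comp_smul_normalize {f : E → ℝ} (hf : Differentiable ℝ f) (hθ : ‖θ‖ = 1)
    (ht : 0 < t) : ∇ (fun y => f (t • ‖y‖⁻¹ • y)) θ = t⁻¹ • sphGrad f (t • θ) := by
  refine ext_inner_right ℝ fun v => ?_
  rw [inner_gradient_left, fderiv_comp_smul_normalize hf hθ, sphGrad, norm_smul, hθ, euler,
    real_inner_smul_left, inner_sub_left, real_inner_smul_left, real_inner_smul_left,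
    real_inner_smul_left, inner_gradient_left, map_smul, Real.norm_of_nonneg ht.le]
  simp only [smul_apply, sub_apply, ContinuousLinearMap.smulRight_apply, coe_innerSL_apply,
    smul_eq_mul, mul_one]
  field_simp

theorem divergence_comp_smul_normalize {f : E → ℝ} (hf : ContDiff ℝ 2 f) (hθ : ‖θ‖ = 1)
    (ht : 0 < t) :
    divergence (fun y => sphGrad f (t • ‖y‖⁻¹ • y)) θ = t * sphLaplacian f (t • θ) := by
  have hX : Differentiable ℝ (sphGrad f) :=
    (contDiff_sphGrad hf (m := 1) (by norm_num)).differentiable one_ne_zero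
  have hradial : inner ℝ θ (fderiv ℝ (sphGrad f) (t • θ) θ) = 0 := by
    have h : inner ℝ (t • θ) (euler (sphGrad f) (t • θ)) = 0 := by
      rw [euler_sphGrad hf, inner_add_right, inner_self_sphGrad, inner_self_sphGrad, add_zero]
    simpa [euler, real_inner_smul_left, real_inner_smul_right, ht.ne'] using h
  have htrace := LinearMap.trace_smulRight (innerSL ℝ θ : E →ₗ[ℝ] ℝ)
    (fderiv ℝ (sphGrad f) (t • θ) θ)
  rw [divergence, fderiv_comp_smul_normalize hX hθ, ContinuousLinearMap.toLinearMap_smul,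
    ContinuousLinearMap.toLinearMap_sub, map_smul, map_sub, sphLaplacian, divergence, smul_eq_mul]
  congr 1
  exact sub_eq_self.2 (htrace.trans hradial)

theorem gradient_comp_smul (f : E → ℝ) (t : ℝ) :
    ∇ (fun y => f (t • y)) = fun y => t • ∇ f (t • y) := by
  funext y
  simp [gradient, fderiv_comp_smul]

theorem laplacian_comp_smul {f : E → ℝ} (hf : ContDiff ℝ 2 f) (t : ℝ) (y : E) :
    (Δ fun z => f (t • z)) y = t ^ 2 * (Δ f) (t • y) := by
  have hd : DifferentiableAt ℝ (fun z => ∇ f (t • z)) y :=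
    ((contDiff_gradient hf (m := 1) (by norm_num)).differentiable one_ne_zero).comp
      (differentiable_id.const_smul t) y
  have hft : ContDiff ℝ 2 fun z => f (t • z) := hf.comp (contDiff_const_smul t)
  rw [laplacian_eq_divergence_gradient hft, laplacian_eq_divergence_gradient hf,
    gradient_comp_smul, divergence, divergence, fderiv_fun_const_smul hd, fderiv_comp_smul]
  simp [sq, mul_assoc]

theorem euler_sphGrad_ladder {f : E → ℝ} (c : ℝ) (j : ℕ) (hf : ContDiff ℝ 2 (ladder c f j))
    (y : E) :
    euler (sphGrad (ladder c f j)) y + (c - 1 - j) • sphGrad (ladder c f j) y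
      = sphGrad (ladder c f (j + 1)) y := by
  have hd := hf.differentiable two_ne_zero
  have he : ContDiff ℝ 1 (euler (ladder c f j)) := contDiff_euler hf (by norm_num)
  rw [ladder, sphGrad_add (he.differentiable one_ne_zero y) ((hd y).const_mul _),
    sphGrad_const_mul (hd y), euler_sphGrad hf]
  module

end Normalize

section Rescale

variable {n : ℕ} {p : ℝ} {x : Space n} {u : Space n → ℝ} {t : ℝ} {θ : Space n}

local notation "U" => fun y => u (x + y)

local notation "W" => ladder (kappa p) U

theorem angularGradient_rescale (hU : Differentiable ℝ U) (ht : 0 < t) (hθ : ‖θ‖ = 1) :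
    angularGradient (rescale p x u t) θ = t ^ (kappa p - 1) • sphGrad U (t • θ) := by
  have hd : DifferentiableAt ℝ (fun y : Space n => u (x + t • ‖y‖⁻¹ • y)) θ :=
    (hU _).comp θ ((hasFDerivAt_normalize hθ).differentiableAt.const_smul t)
  have h : rayExtension (rescale p x u t)
    = fun y : Space n => t ^ kappa p * u (x + t • ‖y‖⁻¹ • y) := rfl
  rw [angularGradient, h, gradient_const_mul hd, gradient_comp_smul_normalize hU hθ ht,
    smul_smul, Real.rpow_sub_one ht.ne', div_eq_mul_inv]

theorem angularDiv_rescale (hU : ContDiff ℝ 2 U) (ht : 0 < t) (hθ : ‖θ‖ = 1) :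
    angularDiv (angularGradient (rescale p x u t)) θ = t ^ kappa p * sphLaplacian U (t • θ) := by
  have h0 : θ ≠ 0 := norm_pos_iff.1 (by rw [hθ]; exact one_pos)
  have hext : rayExtension (angularGradient (rescale p x u t))
      =ᶠ[𝓝 θ] fun y => t ^ (kappa p - 1) • sphGrad U (t • ‖y‖⁻¹ • y) := by
    filter_upwards [isOpen_ne.mem_nhds h0] with y hy
    refine angularGradient_rescale (hU.differentiable two_ne_zero) ht ?_
    rw [norm_smul, norm_inv, norm_norm, inv_mul_cancel₀ (norm_ne_zero_iff.2 hy)]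
  have hd : DifferentiableAt ℝ (fun y => sphGrad U (t • ‖y‖⁻¹ • y)) θ :=
    ((contDiff_sphGrad hU (m := 1) (by norm_num)).differentiable one_ne_zero _).comp θ
      ((hasFDerivAt_normalize hθ).differentiableAt.const_smul t)
  rw [angularDiv, hext.fderiv_eq, fderiv_fun_const_smul hd, ContinuousLinearMap.toLinearMap_smul,
    map_smul, ← divergence, divergence_comp_smul_normalize hU hθ ht, smul_eq_mul, ← mul_assoc,
    ← Real.rpow_add_one ht.ne', sub_add_cancel]

theorem laplacian_rescale (hU : ContDiff ℝ 2 U) (ht : 0 < t) (y : Space n) :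
    (Δ (rescale p x u t)) y = t ^ (kappa p + 2) * (Δ U) (t • y) := by
  have h : rescale p x u t = t ^ kappa p • fun z => u (x + t • z) := rfl
  have hd : ContDiff ℝ 2 fun z => u (x + t • z) := hU.comp (contDiff_const_smul t)
  rw [h, InnerProductSpace.laplacian_smul _ hd.contDiffAt, laplacian_comp_smul hU, smul_eq_mul,
    Real.rpow_add ht, Real.rpow_two, mul_assoc]

theorem iteratedDeriv_ray {F : Type*} [NormedAddCommGroup F] [NormedSpace ℝ F] {c : ℝ}
    {g : ℕ → Space n → F} {J : ℕ} (hg : ∀ j < J, Differentiable ℝ (g j))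
    (hstep : ∀ j < J, ∀ y, euler (g j) y + (c - j) • g j y = g (j + 1) y) {f : ℝ → F}
    (h0 : ∀ s > 0, f s = s ^ c • g 0 (s • θ)) {j : ℕ} (hj : j ≤ J) (ht : 0 < t) :
    iteratedDeriv j f t = t ^ (c - j) • g j (t • θ) := by
  induction j generalizing t with
  | zero => simpa using h0 t ht
  | succ j ih =>
    have hev : iteratedDeriv j f =ᶠ[𝓝 t] fun s => s ^ (c - j) • g j (s • θ) := by
      filter_upwards [lt_mem_nhds ht] with s hs
      exact ih (Nat.le_of_succ_le hj) hs
    rw [iteratedDeriv_succ, hev.deriv_eq, (hasDerivAt_rpow_smul_ray (hg j hj) _ θ ht).deriv,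
      hstep j hj, Nat.cast_add_one, sub_sub]

theorem iteratedDeriv_rescale {j : ℕ} (hU : ContDiff ℝ j U) (ht : 0 < t) :
    iteratedDeriv j (fun s => rescale p x u s θ) t = t ^ (kappa p - j) * W j (t • θ) := by
  have hW (i : ℕ) (hi : i < j) : Differentiable ℝ (W i) := by
    refine (contDiff_ladder _ i hU (m := 1) ?_).differentiable one_ne_zero
    exact_mod_cast (by omega : 1 + i ≤ j)
  exact iteratedDeriv_ray (c := kappa p) (g := W) hW (fun _ _ _ => rfl) (fun _ _ => rfl) le_rfl ht

theorem iteratedDeriv_angularGradient_rescale {j : ℕ} (hU : ContDiff ℝ (j + 1 : ℕ) U)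
    (ht : 0 < t) (hθ : ‖θ‖ = 1) :
    iteratedDeriv j (fun s => angularGradient (rescale p x u s) θ) t
      = t ^ (kappa p - 1 - j) • sphGrad (W j) (t • θ) := by
  have hW (i : ℕ) (hi : i < j) : ContDiff ℝ 2 (W i) := by
    refine contDiff_ladder _ i hU ?_
    exact_mod_cast (by omega : 2 + i ≤ j + 1)
  exact iteratedDeriv_ray (g := fun i => sphGrad (W i))
    (fun i hi => (contDiff_sphGrad (hW i hi) (m := 1) (by norm_num)).differentiable one_ne_zero)
    (fun i hi => euler_sphGrad_ladder _ i (hW i hi))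
    (fun s hs => angularGradient_rescale
      (hU.differentiable (by exact_mod_cast Nat.succ_ne_zero j)) hs hθ) le_rfl ht

theorem deriv_angularDiv_rescale (hU : ContDiff ℝ 3 U) (ht : 0 < t) (hθ : ‖θ‖ = 1) :
    deriv (fun s => angularDiv (angularGradient (rescale p x u s)) θ) t
      = t ^ (kappa p - 1) * sphLaplacian (W 1) (t • θ) := by
  have hS := (hasScalingDeriv_ladder_one (kappa p) hU (by norm_num)).sphLaplacian hU
  have hev : (fun s => angularDiv (angularGradient (rescale p x u s)) θ)
      =ᶠ[𝓝 t] fun s => s ^ kappa p • sphLaplacian U (s • θ) := by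
    filter_upwards [lt_mem_nhds ht] with s hs
    exact angularDiv_rescale (hU.of_le (by norm_num)) hs hθ
  rw [hev.deriv_eq, (hasDerivAt_rpow_smul_ray hS.differentiable _ θ ht).deriv, smul_eq_mul,
    smul_eq_mul, hS.euler_add_mul]

theorem deriv_laplacian_rescale (hU : ContDiff ℝ 3 U) (ht : 0 < t) :
    deriv (fun s => (Δ (rescale p x u s)) θ) t
      = t ^ (kappa p + 1) * (Δ (W 1)) (t • θ) := by
  have hL := (hasScalingDeriv_ladder_one (kappa p) hU (by norm_num)).laplacian hU
  have hev : (fun s => (Δ (rescale p x u s)) θ)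
      =ᶠ[𝓝 t] fun s => s ^ (kappa p + 2) • (Δ U) (s • θ) := by
    filter_upwards [lt_mem_nhds ht] with s hs
    exact laplacian_rescale (hU.of_le (by norm_num)) hs θ
  rw [hev.deriv_eq, (hasDerivAt_rpow_smul_ray hL.differentiable _ θ ht).deriv, smul_eq_mul,
    smul_eq_mul, hL.euler_add_mul, show kappa p + 2 - 1 = kappa p + 1 by ring]

theorem mul_sphIntegral_eq_mul_unitSphereIntegral {a b : ℝ} {q f : Space n → ℝ}
    (h : ∀ θ, ‖θ‖ = 1 → a * q (t • θ) = b * f θ) :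
    a * sphIntegral q t = b * unitSphereIntegral f := by
  rw [sphIntegral, unitSphereIntegral, ← integral_const_mul, ← integral_const_mul]
  exact integral_congr_ae (.of_forall fun θ => h θ (by simp))

theorem pow_mul_rpow_sq (ht : 0 < t) (m : ℕ) {a b : ℝ} (h : 2 * a + m = b) :
    t ^ m * (t ^ a) ^ 2 = t ^ b := by
  rw [← h, Real.rpow_add ht, Real.rpow_natCast, mul_comm 2 a, Real.rpow_mul ht.le, Real.rpow_two,
    mul_comm]

theorem rpow_mul_sphIntegral_radialDissipation (hU : ContDiff ℝ 3 U) (ht : 0 < t) :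
    t ^ (2 * kappa p - 1) * sphIntegral (radialDissipation p U) t
      = unitSphereIntegral (fun θ =>
          2 * t ^ 5 * (iteratedDeriv 3 (fun s => rescale p x u s θ) t) ^ 2
          + (10 * delta1 n p - 2 * delta2 n p - 56) * t ^ 3
            * (iteratedDeriv 2 (fun s => rescale p x u s θ) t) ^ 2
          + (-18 * delta1 n p + 6 * delta2 n p - 4 * delta3 n p + 2 * delta4 n p + 72) * t
            * (deriv (fun s => rescale p x u s θ) t) ^ 2) := by
  have h5 := pow_mul_rpow_sq ht 5 (a := kappa p - (3 : ℕ)) (b := 2 * kappa p - 1)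
    (by push_cast; ring)
  have h3 := pow_mul_rpow_sq ht 3 (a := kappa p - (2 : ℕ)) (b := 2 * kappa p - 1)
    (by push_cast; ring)
  have h1 := pow_mul_rpow_sq ht 1 (a := kappa p - (1 : ℕ)) (b := 2 * kappa p - 1)
    (by push_cast; ring)
  rw [← one_mul (unitSphereIntegral _)]
  refine mul_sphIntegral_eq_mul_unitSphereIntegral fun θ _ => ?_
  rw [radialDissipation, ← iteratedDeriv_one, iteratedDeriv_rescale (j := 3) hU ht,
    iteratedDeriv_rescale (j := 2) (hU.of_le (by norm_num)) ht,
    iteratedDeriv_rescale (j := 1) (hU.of_le (by norm_num)) ht]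
  linear_combination (-2 * W 3 (t • θ) ^ 2) * h5
    - ((10 * delta1 n p - 2 * delta2 n p - 56) * W 2 (t • θ) ^ 2) * h3
    - ((-18 * delta1 n p + 6 * delta2 n p - 4 * delta3 n p + 2 * delta4 n p + 72)
      * W 1 (t • θ) ^ 2) * h1

theorem norm_smul_sphGrad_sq (f : Space n → ℝ) (c : ℝ) (ht : 0 < t) (hθ : ‖θ‖ = 1) :
    ‖c • sphGrad f (t • θ)‖ ^ 2 = t ^ 2 * c ^ 2 * sphInner f f (t • θ) := by
  rw [norm_smul, mul_pow, norm_sphGrad_sq, norm_smul, hθ, mul_one, Real.norm_eq_abs, sq_abs,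
    Real.norm_of_nonneg ht.le]
  ring

theorem rpow_mul_sphIntegral_sphInner (hU : ContDiff ℝ 3 U) (ht : 0 < t) (a b : ℝ) :
    t ^ (2 * kappa p - 1)
        * sphIntegral (fun y => a * sphInner (W 2) (W 2) y + b * sphInner (W 1) (W 1) y) t
      = unitSphereIntegral (fun θ =>
          a * t ^ 3 * ‖iteratedDeriv 2 (fun s => angularGradient (rescale p x u s) θ) t‖ ^ 2
          + b * t * ‖deriv (fun s => angularGradient (rescale p x u s) θ) t‖ ^ 2) := by
  have h5 := pow_mul_rpow_sq ht 5 (a := kappa p - 1 - (2 : ℕ)) (b := 2 * kappa p - 1)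
    (by push_cast; ring)
  have h3 := pow_mul_rpow_sq ht 3 (a := kappa p - 1 - (1 : ℕ)) (b := 2 * kappa p - 1)
    (by push_cast; ring)
  rw [← one_mul (unitSphereIntegral _)]
  refine mul_sphIntegral_eq_mul_unitSphereIntegral fun θ hθ => ?_
  rw [← iteratedDeriv_one, iteratedDeriv_angularGradient_rescale (j := 2) hU ht hθ,
    iteratedDeriv_angularGradient_rescale (j := 1) (hU.of_le (by norm_num)) ht hθ,
    norm_smul_sphGrad_sq _ _ ht hθ, norm_smul_sphGrad_sq _ _ ht hθ]
  linear_combination (-a * sphInner (W 2) (W 2) (t • θ)) * h5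
    - (b * sphInner (W 1) (W 1) (t • θ)) * h3

theorem rpow_mul_sphIntegral_sphLaplacian_sq (hU : ContDiff ℝ 3 U) (ht : 0 < t) :
    t ^ (2 * kappa p - 1) * sphIntegral (fun y => sphLaplacian (W 1) y ^ 2) t
      = t * unitSphereIntegral (fun θ =>
          (deriv (fun s => angularDiv (angularGradient (rescale p x u s)) θ) t) ^ 2) := by
  refine mul_sphIntegral_eq_mul_unitSphereIntegral fun θ hθ => ?_
  rw [deriv_angularDiv_rescale hU ht hθ,
    ← pow_mul_rpow_sq ht 1 (a := kappa p - 1) (by push_cast; ring)]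
  ring

theorem rpow_mul_sphIntegral_laplacian_sq (hU : ContDiff ℝ 3 U) (ht : 0 < t) :
    t ^ (2 * kappa p - 1) * sphIntegral (fun y => (‖y‖ ^ 2 * (Δ (W 1)) y) ^ 2) t
      = t * unitSphereIntegral (fun θ => (deriv (fun s => (Δ (rescale p x u s)) θ) t) ^ 2) := by
  have h := pow_mul_rpow_sq ht 1 (a := kappa p + 1) (b := 2 * kappa p - 1 + (4 : ℕ))
    (by push_cast; ring)
  rw [Real.rpow_add_natCast ht.ne'] at h
  refine mul_sphIntegral_eq_mul_unitSphereIntegral fun θ hθ => ?_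
  rw [deriv_laplacian_rescale hU ht, norm_smul, hθ, Real.norm_of_nonneg ht.le]
  linear_combination (-(Δ (W 1)) (t • θ) ^ 2) * h

theorem sphIntegral_dissipation (hU : ContDiff ℝ 6 U) (t : ℝ) :
    sphIntegral (dissipation p U) t = sphIntegral (radialDissipation p U) t
      + sphIntegral (fun y => 4 * sphInner (W 2) (W 2) y
          + (8 * alpha n p - 4 * beta n p + 4 * n - 28) * sphInner (W 1) (W 1) y) t
      + 2 * sphIntegral (fun y => sphLaplacian (W 1) y ^ 2) t
      + sphIntegral (fun y => (‖y‖ ^ 2 * (Δ (W 1)) y) ^ 2) t := by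
  have hW (i : ℕ) (hi : i ≤ 3) : Continuous (W i) :=
    (contDiff_ladder _ i hU (m := 3) (by exact_mod_cast (by omega : 3 + i ≤ 6))).continuous
  have hW1 := hW 1 (by norm_num)
  have hW2 := hW 2 (by norm_num)
  have hW3 := hW 3 (by norm_num)
  have hI (i : ℕ) (hi : i ≤ 2) : Continuous (sphInner (W i) (W i)) :=
    (contDiff_sphInner_ladder _ i i hU (m := 1) (by exact_mod_cast (by omega : 1 + 1 + i ≤ 6))
      (by exact_mod_cast (by omega : 1 + 1 + i ≤ 6))).continuous
  have hI1 := hI 1 (by norm_num)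
  have hI2 := hI 2 (by norm_num)
  have hS : Continuous (sphLaplacian (W 1)) :=
    (contDiff_sphLaplacian_ladder _ 1 hU (m := 1) (by norm_num)).continuous
  have hΔ : Continuous (Δ (W 1)) :=
    (contDiff_laplacian (contDiff_ladder _ 1 hU (m := 3) (by norm_num)) (m := 1)
      (by norm_num)).continuous
  have hR : Continuous (radialDissipation p U) := by
    unfold radialDissipation
    fun_prop
  have hA : Continuous (angularDissipation p U) := by
    unfold angularDissipation
    fun_prop
  unfold dissipation
  rw [sphIntegral_add (by fun_prop) (by fun_prop), sphIntegral_add hR hA]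
  unfold angularDissipation
  rw [sphIntegral_add (by fun_prop) (by fun_prop), sphIntegral_const_mul, ← add_assoc]

theorem rpow_mul_sphIntegral_dissipation (hU : ContDiff ℝ 6 U) (ht : 0 < t) :
    t ^ (2 * kappa p - 1) * sphIntegral (dissipation p U) t
      = unitSphereIntegral (fun θ =>
          2 * t ^ 5 * (iteratedDeriv 3 (fun s => rescale p x u s θ) t) ^ 2
          + (10 * delta1 n p - 2 * delta2 n p - 56) * t ^ 3
            * (iteratedDeriv 2 (fun s => rescale p x u s θ) t) ^ 2
          + (-18 * delta1 n p + 6 * delta2 n p - 4 * delta3 n p + 2 * delta4 n p + 72) * t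
            * (deriv (fun s => rescale p x u s θ) t) ^ 2)
        + unitSphereIntegral (fun θ =>
          4 * t ^ 3 * ‖iteratedDeriv 2 (fun s => angularGradient (rescale p x u s) θ) t‖ ^ 2
          + (8 * alpha n p - 4 * beta n p + 4 * n - 28) * t
            * ‖deriv (fun s => angularGradient (rescale p x u s) θ) t‖ ^ 2)
        + 2 * t * unitSphereIntegral (fun θ =>
            (deriv (fun s => angularDiv (angularGradient (rescale p x u s)) θ) t) ^ 2)
        + t * unitSphereIntegral (fun θ => (deriv (fun s => (Δ (rescale p x u s)) θ) t) ^ 2) := by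
  have h3 : ContDiff ℝ 3 U := hU.of_le (by norm_num)
  rw [sphIntegral_dissipation hU]
  linear_combination rpow_mul_sphIntegral_radialDissipation (p := p) h3 ht
    + rpow_mul_sphIntegral_sphInner (p := p) h3 ht 4 (8 * alpha n p - 4 * beta n p + 4 * n - 28)
    + 2 * rpow_mul_sphIntegral_sphLaplacian_sq (p := p) h3 ht
    + rpow_mul_sphIntegral_laplacian_sq (p := p) h3 ht

end Rescale

end Triharmonic

end

theorem theorem2p1 (n : ℕ) (hn : 1 ≤ n) (p : ℝ) (hp : 1 < p)
    (u : Triharmonic.Space n → ℝ) (hu : Triharmonic.IsSolution p u)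
    (x : Triharmonic.Space n) (lam : ℝ) (hlam : 0 < lam) :
    HasDerivAt (fun t : ℝ => Triharmonic.energy p t x u)
      (Triharmonic.unitSphereIntegral (fun θ =>
          2 * lam ^ 5 * (iteratedDeriv 3 (fun t => Triharmonic.rescale p x u t θ) lam) ^ 2
          + (10 * Triharmonic.delta1 n p - 2 * Triharmonic.delta2 n p - 56) * lam ^ 3
            * (iteratedDeriv 2 (fun t => Triharmonic.rescale p x u t θ) lam) ^ 2
          + (-18 * Triharmonic.delta1 n p + 6 * Triharmonic.delta2 n p
              - 4 * Triharmonic.delta3 n p + 2 * Triharmonic.delta4 n p + 72) * lam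
            * (deriv (fun t => Triharmonic.rescale p x u t θ) lam) ^ 2)
        + Triharmonic.unitSphereIntegral (fun θ =>
          4 * lam ^ 3 * ‖iteratedDeriv 2
            (fun t => Triharmonic.angularGradient (Triharmonic.rescale p x u t) θ) lam‖ ^ 2
          + (8 * Triharmonic.alpha n p - 4 * Triharmonic.beta n p + 4 * n - 28) * lam
            * ‖deriv
              (fun t => Triharmonic.angularGradient (Triharmonic.rescale p x u t) θ) lam‖ ^ 2)
        + 2 * lam * Triharmonic.unitSphereIntegral (fun θ =>
            (deriv (fun t => Triharmonic.angularDiv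
              (Triharmonic.angularGradient (Triharmonic.rescale p x u t)) θ) lam) ^ 2)
        + lam * Triharmonic.unitSphereIntegral (fun θ =>
            (deriv (fun t => (Δ (Triharmonic.rescale p x u t)) θ) lam) ^ 2))
      lam := by
  have : NeZero n := ⟨by omega⟩
  have : Nontrivial (Triharmonic.Space n) := inferInstanceAs (Nontrivial (EuclideanSpace ℝ (Fin n)))
  obtain ⟨hU, heq⟩ := hu.shift x
  have h := (Triharmonic.hasDerivAt_bulk hp hU heq hlam).fun_add
    (Triharmonic.hasDerivAt_rpow_mul_sphIntegral
      (Triharmonic.contDiff_boundaryDensity (p := p) hU) (2 * Triharmonic.kappa p) hlam)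
  rw [finrank_euclideanSpace_fin, ← mul_add, Triharmonic.sphIntegral_balance hU hlam,
    Triharmonic.rpow_mul_sphIntegral_dissipation hU hlam] at h
  refine h.congr_of_eventuallyEq ?_
  filter_upwards [lt_mem_nhds hlam] with t ht
  exact Triharmonic.energy_eq hn hp hU ht
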